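/- Let $\mathbb T=\mathbb R/2\pi\mathbb Z$. For $f=\sum_{k\in\mathbb Z}f_ke^{ikx}$ put $\|f\|_{H^s}=\big(\sum_{k}(1+k^2)^s|f_k|^2\big)^{1/2}$ and $\Pi_+f=\sum_{k\ge 0}f_ke^{ikx}$, and let $\mathcal C^\infty_+(\mathbb T)$ be the set of smooth $f:\mathbb T\to\mathbb C$ with $f_k=0$ for all $k<0$. For every integer $n\ge 0$ there is a constant $B_n>0$, depending only on $n$, such that the following holds for every $u_0\in \mathcal C^\infty_+(\mathbb T)$ and every solution $u\in \mathcal C^\infty(\mathbb R\times\mathbb T)$ of the cubic Szegő equation $$i\partial_tu=\Pi_+(|u|^2u),\qquad u(0)=u_0 .$$ (1) There is a constant $C>0$, depending only on $n$ and $\|u_0\|_{H^{1+n}}$, such that for all $t\in\mathbb R$, $u(t)$ has finite $H^{1+n}$ norm and $$\|u(t)\|_{H^{1+n}}\le C\,e^{B|t|^2},\qquad B=B_n\max\big(1,\|u_0\|_{H^{1/2}}\big)^8 ;$$ in particular, $B=B_n\|u_0\|_{H^{1/2}}^8$ whenever $\|u_0\|_{H^{1/2}}\ge 1$. (2) Without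 any lower bound on $\|u_0\|_{H^{1/2}}$, there is a constant $C>0$, which may depend on $n$ and on $u_0$, such that for all $t\in\mathbb R$, $$\|u(t)\|_{H^{1+n}}\le C\,e^{B|t|^2},\qquad B=B_n\|u_0\|_{H^{1/2}}^8 .$$ -/

import Mathlib

open scoped ContDiff

noncomputable section

/-- The length `2π` of the torus is positive. -/
instance szegoTorusFact : Fact (0 < 2 * Real.pi) := ⟨Real.two_pi_pos⟩

/-- The one-dimensional torus `ℝ / 2πℤ`. The function `fourier k` on it is `x ↦ exp (i k x)`. -/
abbrev SzegoTorus : Type := AddCircle (2 * Real.pi)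

/-- `f` is a smooth complex-valued function on the torus. -/
def SmoothOnTorus (f : SzegoTorus → ℂ) : Prop :=
  ContDiff ℝ ∞ (fun x : ℝ => f (x : SzegoTorus))

/-- `f` is a smooth function on the torus with only nonnegative frequencies. -/
def SmoothPlus (f : SzegoTorus → ℂ) : Prop :=
  SmoothOnTorus f ∧ ∀ k : ℤ, k < 0 → fourierCoeff f k = 0

/-- The Szegő projector onto nonnegative Fourier modes,
`Π₊ f (x) = ∑_{k ≥ 0} f_k exp (i k x)`. It is only applied to smooth functions, whose Fourier
series converges absolutely. -/
def szegoProj (f : SzegoTorus → ℂ) (x : SzegoTorus) : ℂ :=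
  ∑' k : ℕ, fourierCoeff f (k : ℤ) * fourier (k : ℤ) x

/-- The summand `(1 + k²)^s |f_k|²` of the squared Sobolev norm. -/
def sobolevTerm (s : ℝ) (f : SzegoTorus → ℂ) (k : ℤ) : ℝ :=
  (1 + (k : ℝ) ^ 2) ^ s * ‖fourierCoeff f k‖ ^ 2

/-- The `H^s` norm of `f` is finite. -/
def FiniteSobolev (s : ℝ) (f : SzegoTorus → ℂ) : Prop :=
  Summable (sobolevTerm s f)

/-- The `H^s` norm on the torus, `(∑_k (1 + k²)^s |f_k|²)^{1/2}` (meaningful when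
`FiniteSobolev s f`, which holds for every smooth `f`). -/
def sobolevNorm (s : ℝ) (f : SzegoTorus → ℂ) : ℝ :=
  Real.sqrt (∑' k : ℤ, sobolevTerm s f k)

/-- `u` is a global smooth solution (jointly smooth in time and space) of the cubic Szegő equation
`i ∂ₜ u = Π₊(|u|² u)`, with initial value `u₀`. -/
structure IsSzegoSolution (u₀ : SzegoTorus → ℂ) (u : ℝ → SzegoTorus → ℂ) : Prop where
  smooth : ContDiff ℝ ∞ (fun p : ℝ × ℝ => u p.1 (p.2 : SzegoTorus))
  initial : u 0 = u₀
  equation : ∀ (t : ℝ) (x : SzegoTorus),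
    Complex.I * deriv (fun τ : ℝ => u τ x) t =
      szegoProj (fun y => ((‖u t y‖ ^ 2 : ℝ) : ℂ) * u t y) x

end

/-! On Fourier coefficients the equation reads `c_k' = -i Σ c_i c_l conj(c_q)`, summed over `i + l =
q + k`. Symmetrising the quartic sum, the derivative of `Σ w_k |c_k|²` involves only the resonant
differences `w_q + w_k - w_i - w_l`. They vanish for affine weights, so the `H^{1/2}`-type quantity
`Σ (1 + k)|c_k|²` is conserved (`halfNorm_const`).

For the weight of `H^{1+n}`, order the frequencies as `l ≤ k ≤ q ≤ i`. Since `i - q = k - l ≤ k`,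
the difference gains a factor `k / (1 + i)`. Together with a count of the admissible `i`, this gives
`|F'| ≲ μ ‖c‖_{ℓ¹} F`, where `F` is the squared `H^{1+n}` norm and `μ²` bounds the conserved
quantity (`tsum_resonantDiff_quartic_le`).

The two bounds control the `ℓ¹` norm differently. A Brezis–Gallouet inequality `‖c‖_{ℓ¹} ≲ m √log(3
+ F)` makes `√log(3 + F)` Lipschitz in time with constant of order `m²`. Hence `log F` grows at most
like `m⁴ t²`, and `m⁴` is below the eighth power once `m ≥ 1`.

For small data that last comparison fails, and complete integrability is used instead. The Hankel
matrix `(c_{j+k})` satisfies a Lax equation `H' = A H + H Aᵀ` with `A` anti-Hermitian, so its trace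
norm is conserved. The trace norm dominates the `ℓ¹` norm of `c` up to a factor `2`, so `‖c‖_{ℓ¹}`
is bounded for all time (`SzegoFlow.tsum_norm_le`). Then `F` grows at most exponentially, which a
Gaussian of any positive rate absorbs at the price of a constant depending on the data. The Lax
argument runs on `N × N` truncations, whose error vanishes as `N → ∞`. -/

noncomputable section

/-! ### Fourier coefficients in space: time derivative and rapid decay. -/

open MeasureTheory Filter Topology Set

/-- The `k`-th Fourier coefficient in the second variable of a function on the plane. -/
def partialCoeff (G : ℝ × ℝ → ℂ) (k : ℤ) (t : ℝ) : ℂ :=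
  (1 / (2 * Real.pi)) • ∫ x in (0 : ℝ)..2 * Real.pi, fourier (-k) (x : SzegoTorus) • G (t, x)

theorem fourierCoeff_eq_partialCoeff (v : ℝ → SzegoTorus → ℂ) (k : ℤ) (t : ℝ) :
    fourierCoeff (v t) k = partialCoeff (fun p => v p.1 (p.2 : SzegoTorus)) k t := by
  rw [fourierCoeff_eq_intervalIntegral _ _ 0, zero_add]
  rfl

theorem continuous_fourier_coe (k : ℤ) : Continuous fun x : ℝ => fourier k (x : SzegoTorus) :=
  (map_continuous (fourier k)).comp (AddCircle.continuous_mk' _)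

theorem norm_fourier_apply (k : ℤ) (x : SzegoTorus) : ‖fourier k x‖ = 1 := by
  rw [fourier_apply]; exact Circle.norm_coe _

theorem hasDerivAt_fst {G : ℝ × ℝ → ℂ} (hG : ContDiff ℝ ∞ G) (p : ℝ × ℝ) :
    HasDerivAt (fun τ => G (τ, p.2)) (fderiv ℝ G p (1, 0)) p.1 := by
  have h := (hG.differentiable (by simp) p).hasFDerivAt
  have h2 : HasDerivAt (fun τ : ℝ => (τ, p.2)) ((1 : ℝ), (0 : ℝ)) p.1 :=
    (hasDerivAt_id _).prodMk (hasDerivAt_const _ _)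
  exact HasFDerivAt.comp_hasDerivAt (l := G) (f := fun τ : ℝ => (τ, p.2)) p.1 h h2

theorem hasDerivAt_snd {G : ℝ × ℝ → ℂ} (hG : ContDiff ℝ ∞ G) (p : ℝ × ℝ) :
    HasDerivAt (fun x => G (p.1, x)) (fderiv ℝ G p (0, 1)) p.2 := by
  have h := (hG.differentiable (by simp) p).hasFDerivAt
  have h2 : HasDerivAt (fun x : ℝ => (p.1, x)) ((0 : ℝ), (1 : ℝ)) p.2 :=
    (hasDerivAt_const _ _).prodMk (hasDerivAt_id _)
  exact HasFDerivAt.comp_hasDerivAt (l := G) (f := fun x : ℝ => (p.1, x)) p.2 h h2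

theorem contDiff_partial {G : ℝ × ℝ → ℂ} (hG : ContDiff ℝ ∞ G) (v : ℝ × ℝ) :
    ContDiff ℝ ∞ (fun p => fderiv ℝ G p v) :=
  (hG.fderiv_right (m := ∞) (by simp)).clm_apply contDiff_const

/-- A continuous function is bounded on `[-T, T] × [0, 2π]`. -/
theorem exists_bound_strip {G : ℝ × ℝ → ℂ} (hG : Continuous G) (T : ℝ) :
    ∃ C, 0 ≤ C ∧ ∀ t, |t| ≤ T → ∀ x ∈ Icc 0 (2 * Real.pi), ‖G (t, x)‖ ≤ C := by
  obtain ⟨C, hC⟩ := (isCompact_Icc (a := -T) (b := T)).prod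
    (isCompact_Icc (a := (0 : ℝ)) (b := 2 * Real.pi)) |>.exists_bound_of_continuousOn
    hG.continuousOn
  exact ⟨max C 0, le_max_right _ _, fun t ht x hx =>
    (hC (t, x) ⟨abs_le.mp ht, hx⟩).trans (le_max_left _ _)⟩

theorem norm_partialCoeff_le {G : ℝ × ℝ → ℂ} {C t : ℝ}
    (hC : ∀ x ∈ Icc 0 (2 * Real.pi), ‖G (t, x)‖ ≤ C) (k : ℤ) : ‖partialCoeff G k t‖ ≤ C := by
  have h2 := Real.two_pi_pos
  have : ‖∫ x in (0 : ℝ)..2 * Real.pi, fourier (-k) (x : SzegoTorus) • G (t, x)‖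
      ≤ C * |2 * Real.pi - 0| := by
    refine intervalIntegral.norm_integral_le_of_norm_le_const fun x hx => ?_
    rw [uIoc_of_le h2.le] at hx
    rw [norm_smul, norm_fourier_apply, one_mul]
    exact hC x ⟨hx.1.le, hx.2⟩
  rw [sub_zero, abs_of_pos h2] at this
  rw [partialCoeff, norm_smul, Real.norm_of_nonneg (by positivity), one_div_mul_eq_div,
    div_le_iff₀ h2]
  exact this

theorem hasDerivAt_partialCoeff {G : ℝ × ℝ → ℂ} (hG : ContDiff ℝ ∞ G) (k : ℤ) (t : ℝ) :
    HasDerivAt (partialCoeff G k) (partialCoeff (fun p => fderiv ℝ G p (1, 0)) k t) t := by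
  have hG' := contDiff_partial hG (1, 0)
  obtain ⟨C, -, hC⟩ := exists_bound_strip hG'.continuous (|t| + 1)
  have hcont : ∀ {H : ℝ × ℝ → ℂ}, Continuous H → ∀ τ,
      Continuous fun x : ℝ => fourier (-k) (x : SzegoTorus) • H (τ, x) := fun hH τ =>
    (continuous_fourier_coe _).smul (hH.comp (by fun_prop))
  have key := intervalIntegral.hasDerivAt_integral_of_dominated_loc_of_deriv_le
    (s := Metric.ball t 1) (bound := fun _ => C)
    (F := fun τ x => fourier (-k) (x : SzegoTorus) • G (τ, x))
    (F' := fun τ x => fourier (-k) (x : SzegoTorus) • fderiv ℝ G (τ, x) (1, 0))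
    (μ := volume) (a := 0) (b := 2 * Real.pi) (x₀ := t)
    (Metric.ball_mem_nhds t one_pos) ?_ ?_ ?_ ?_ ?_ ?_
  · exact HasDerivAt.const_smul (R := ℝ) (1 / (2 * Real.pi)) key.2
  · exact Eventually.of_forall fun τ => (hcont hG.continuous τ).aestronglyMeasurable
  · exact (hcont hG.continuous t).intervalIntegrable _ _
  · exact (hcont hG'.continuous t).aestronglyMeasurable
  · refine Eventually.of_forall fun x hx τ hτ => ?_
    rw [uIoc_of_le Real.two_pi_pos.le] at hx
    rw [norm_smul, norm_fourier_apply, one_mul]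
    refine hC τ ?_ x ⟨hx.1.le, hx.2⟩
    rw [Metric.mem_ball, Real.dist_eq] at hτ
    linarith [abs_sub_abs_le_abs_sub τ t]
  · exact intervalIntegrable_const
  · exact Eventually.of_forall fun x _ τ _ =>
      (hasDerivAt_fst hG (τ, x)).const_mul (fourier (-k) (x : SzegoTorus))

theorem periodic_partial {G : ℝ × ℝ → ℂ}
    (hp : ∀ t x, G (t, x + 2 * Real.pi) = G (t, x)) (v : ℝ × ℝ) (t x : ℝ) :
    fderiv ℝ G (t, x + 2 * Real.pi) v = fderiv ℝ G (t, x) v := by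
  have h : (fun p : ℝ × ℝ => G (p + (0, 2 * Real.pi))) = G := by
    ext ⟨a, b⟩; simpa using hp a b
  have h2 := fderiv_comp_add_right (𝕜 := ℝ) (f := G) (x := (t, x)) (0, 2 * Real.pi)
  rw [h] at h2
  rw [h2]; simp

/-- Integration by parts over one period; the boundary terms cancel by periodicity. -/
theorem partialCoeff_snd {G : ℝ × ℝ → ℂ} (hG : ContDiff ℝ ∞ G)
    (hp : ∀ t x, G (t, x + 2 * Real.pi) = G (t, x)) (k : ℤ) (t : ℝ) :
    partialCoeff (fun p => fderiv ℝ G p (0, 1)) k t = Complex.I * k * partialCoeff G k t := by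
  have hG' := contDiff_partial hG (0, 1)
  have h2 : (Real.pi : ℂ) ≠ 0 := by exact_mod_cast Real.pi_ne_zero
  have key := intervalIntegral.integral_mul_deriv_eq_deriv_mul (a := 0) (b := 2 * Real.pi)
    (u := fun x : ℝ => fourier (-k) (x : SzegoTorus)) (v := fun x => G (t, x))
    (v' := fun x => fderiv ℝ G (t, x) (0, 1))
    (fun x _ => hasDerivAt_fourier_neg (2 * Real.pi) k x)
    (fun x _ => hasDerivAt_snd hG (t, x))
    ((continuous_const.mul (continuous_fourier_coe _)).intervalIntegrable _ _)
    ((hG'.continuous.comp (by fun_prop : Continuous fun x : ℝ => (t, x))).intervalIntegrable _ _)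
  have hper : G (t, 2 * Real.pi) = G (t, 0) := by simpa using hp t 0
  have hper2 : ((2 * Real.pi : ℝ) : SzegoTorus) = ((0 : ℝ) : SzegoTorus) := by
    simp
  rw [hper, hper2, sub_self, zero_sub] at key
  simp only [mul_assoc] at key
  simp only [partialCoeff, smul_eq_mul]
  rw [key, ← intervalIntegral.integral_neg]
  rw [mul_smul_comm, ← intervalIntegral.integral_const_mul]
  congr 1
  refine intervalIntegral.integral_congr fun x _ => ?_
  push_cast
  field_simp

/-- Each factor `1 + |k|` is traded for at most one `x`-derivative of `G`, so the induction must
range over all periodic smooth `G`. -/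
theorem partialCoeff_decay (N : ℕ) (T : ℝ) : ∀ {G : ℝ × ℝ → ℂ}, ContDiff ℝ ∞ G →
    (∀ t x, G (t, x + 2 * Real.pi) = G (t, x)) →
    ∃ C, 0 ≤ C ∧ ∀ t, |t| ≤ T → ∀ k : ℤ, (1 + |(k : ℝ)|) ^ N * ‖partialCoeff G k t‖ ≤ C := by
  induction N with
  | zero =>
    intro G hG _
    obtain ⟨C, h0, hC⟩ := exists_bound_strip hG.continuous T
    exact ⟨C, h0, fun t ht k => by simpa using norm_partialCoeff_le (hC t ht) k⟩
  | succ N ih =>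
    intro G hG hp
    obtain ⟨C₁, h₁, hC₁⟩ := ih hG hp
    obtain ⟨C₂, h₂, hC₂⟩ := ih (contDiff_partial hG (0, 1)) (periodic_partial hp _)
    refine ⟨C₁ + C₂, by positivity, fun t ht k => ?_⟩
    have e1 := hC₁ t ht k
    have e2 := hC₂ t ht k
    rw [partialCoeff_snd hG hp, norm_mul, norm_mul, Complex.norm_I, one_mul,
      Complex.norm_intCast] at e2
    calc _ = (1 + |(k : ℝ)|) ^ N * ‖partialCoeff G k t‖
        + (1 + |(k : ℝ)|) ^ N * (|(k : ℝ)| * ‖partialCoeff G k t‖) := by ring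
      _ ≤ _ := add_le_add e1 e2

/-- Fourier coefficients of an absolutely convergent superposition of characters. -/
theorem fourierCoeff_tsum {ι : Type*} [Countable ι] {a : ι → ℂ} (ν : ι → ℤ)
    (ha : Summable fun i => ‖a i‖) {f : SzegoTorus → ℂ}
    (hf : ∀ x, f x = ∑' i, a i * fourier (ν i) x) (k : ℤ) :
    fourierCoeff f k = ∑' i, if ν i = k then a i else 0 := by
  have hcoef : ∀ i, ∫ x : SzegoTorus, fourier (-k) x • (a i * fourier (ν i) x)
      ∂AddCircle.haarAddCircle = if ν i = k then a i else 0 := by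
    intro i
    have h := congrFun (fourierCoeff_fourier (T := 2 * Real.pi) (ν i)) k
    rw [fourierCoeff] at h
    simp only [smul_eq_mul] at h ⊢
    simp_rw [mul_left_comm _ (a i)]
    rw [integral_const_mul, h, Pi.single_apply]
    simp [eq_comm]
  have hint : ∀ i, Integrable (fun x : SzegoTorus => fourier (-k) x • (a i * fourier (ν i) x))
      AddCircle.haarAddCircle := fun i =>
    ((map_continuous (fourier (-k))).smul
      (continuous_const.mul (map_continuous (fourier (ν i))))).integrable_of_hasCompactSupport
      (HasCompactSupport.of_compactSpace _)
  have := (hasSum_integral_of_summable_integral_norm hint ?_).tsum_eq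
  · simp_rw [hcoef] at this
    rw [this, fourierCoeff]
    congr 1
    ext x
    rw [hf, smul_eq_mul, ← tsum_mul_left]
    rfl
  · simp only [smul_eq_mul, norm_mul, norm_fourier_apply]
    simpa using ha

end

/-! ### The equation as an infinite system for Fourier coefficients. -/

noncomputable section

open MeasureTheory Filter Topology Set
open scoped ComplexConjugate

/-- The `m`-th Fourier coefficient of `|u|² u`, for `u` with coefficients `c`. -/
def cubicCoeff (c : ℕ → ℂ) (m : ℕ) : ℂ :=
  ∑' x : (ℕ × ℕ) × ℕ, if x.1.1 + x.1.2 = x.2 + m then c x.1.1 * c x.1.2 * conj (c x.2) else 0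

/-- The cubic Szegő equation written on Fourier coefficients, with rapidly decreasing
coefficients, locally uniformly in time. -/
structure SzegoFlow (c : ℝ → ℕ → ℂ) : Prop where
  hasDeriv : ∀ t k, HasDerivAt (fun τ => c τ k) (-Complex.I * cubicCoeff (c t) k) t
  decay : ∀ (N : ℕ) (T : ℝ), ∃ C, 0 ≤ C ∧ ∀ t, |t| ≤ T → ∀ k : ℕ, (1 + (k : ℝ)) ^ N * ‖c t k‖ ≤ C

theorem summable_one_add_inv_sq : Summable fun k : ℕ => ((1 + (k : ℝ)) ^ 2)⁻¹ := by
  have := (summable_nat_add_iff 1).mpr (Real.summable_nat_pow_inv.mpr (by norm_num : 1 < 2))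
  refine this.congr fun k => ?_
  push_cast
  rw [add_comm]

theorem summable_int_of_decay {a : ℤ → ℂ} {C : ℝ}
    (h : ∀ k : ℤ, (1 + |(k : ℝ)|) ^ 2 * ‖a k‖ ≤ C) : Summable fun k => ‖a k‖ := by
  have hb : ∀ k : ℤ, ‖a k‖ ≤ C * ((1 + |(k : ℝ)|) ^ 2)⁻¹ := fun k => by
    rw [← div_eq_mul_inv, le_div_iff₀ (by positivity), mul_comm]
    exact h k
  refine Summable.of_nat_of_neg ?_ ?_
  · refine Summable.of_nonneg_of_le (fun _ => norm_nonneg _) (fun k => hb k) ?_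
    simpa using summable_one_add_inv_sq.mul_left C
  · refine Summable.of_nonneg_of_le (fun _ => norm_nonneg _) (fun k => hb (-k)) ?_
    simpa using summable_one_add_inv_sq.mul_left C

theorem fourierCoeff_cubic {c : ℕ → ℂ} (hc : Summable fun k => ‖c k‖) {f : SzegoTorus → ℂ}
    (hf : ∀ x, f x = ∑' k : ℕ, c k * fourier (k : ℤ) x) (m : ℕ) :
    fourierCoeff (fun y => ((‖f y‖ ^ 2 : ℝ) : ℂ) * f y) m = cubicCoeff c m := by
  have hc' : Summable fun k => ‖conj (c k)‖ := by simpa using hc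
  have h2 : Summable fun x : ℕ × ℕ => ‖c x.1 * c x.2‖ := hc.mul_norm hc
  have h3 : Summable fun x : (ℕ × ℕ) × ℕ => ‖c x.1.1 * c x.1.2 * conj (c x.2)‖ :=
    Summable.mul_norm (f := fun x : ℕ × ℕ => c x.1 * c x.2) (g := fun k => conj (c k)) h2 hc'
  have hs : ∀ {a : ℕ → ℂ}, Summable (fun k => ‖a k‖) → ∀ (ν : ℕ → ℤ) (x : SzegoTorus),
      Summable fun k => ‖a k * fourier (ν k) x‖ := fun ha ν x => by
    simpa only [norm_mul, norm_fourier_apply, mul_one] using ha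
  rw [fourierCoeff_tsum (fun x : (ℕ × ℕ) × ℕ => (x.1.1 : ℤ) + x.1.2 - x.2) h3]
  · exact tsum_congr fun x => if_congr (by omega) rfl rfl
  · intro x
    have hconj : conj (f x) = ∑' k : ℕ, conj (c k) * fourier (-(k : ℤ)) x := by
      rw [hf, Complex.conj_tsum]
      exact tsum_congr fun k => by rw [map_mul, fourier_neg]
    have e : ((‖f x‖ ^ 2 : ℝ) : ℂ) * f x = f x * f x * conj (f x) := by
      rw [Complex.ofReal_pow, ← Complex.mul_conj']; ring
    have hx := hs hc (fun k => (k : ℤ)) x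
    have hx2 := Summable.mul_norm (f := fun k : ℕ => c k * fourier (k : ℤ) x)
      (g := fun k : ℕ => c k * fourier (k : ℤ) x) hx hx
    rw [e, hconj, hf x, tsum_mul_tsum_of_summable_norm hx hx,
      tsum_mul_tsum_of_summable_norm hx2 (hs hc' (fun k => -(k : ℤ)) x)]
    refine tsum_congr fun y => ?_
    rw [sub_eq_add_neg, fourier_add, fourier_add]
    ring

theorem IsSzegoSolution.szegoFlow {u₀ : SzegoTorus → ℂ} {u : ℝ → SzegoTorus → ℂ}
    (h₀ : SmoothPlus u₀) (hu : IsSzegoSolution u₀ u) :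
    SzegoFlow (fun t k => fourierCoeff (u t) (k : ℤ)) ∧
      ∀ t, ∀ k : ℤ, k < 0 → fourierCoeff (u t) k = 0 := by
  set G : ℝ × ℝ → ℂ := fun p => u p.1 (p.2 : SzegoTorus) with hG
  have hGs : ContDiff ℝ ∞ G := hu.smooth
  have hGp : ∀ t x, G (t, x + 2 * Real.pi) = G (t, x) := fun t x => by simp [hG]
  set H : ℝ × ℝ → ℂ := fun p => ((‖G p‖ ^ 2 : ℝ) : ℂ) * G p with hH
  have hHs : ContDiff ℝ ∞ H := (Complex.ofRealCLM.contDiff.comp (hGs.norm_sq ℝ)).mul hGs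
  have hHp : ∀ t x, H (t, x + 2 * Real.pi) = H (t, x) := fun t x => by simp [hH, hGp]
  have hsum : ∀ {v : ℝ → SzegoTorus → ℂ}, ContDiff ℝ ∞ (fun p : ℝ × ℝ => v p.1 p.2) → ∀ t,
      Summable fun k => ‖fourierCoeff (v t) k‖ := fun {v} hv t => by
    obtain ⟨C, -, hC⟩ := partialCoeff_decay 2 |t| hv (fun t x => by simp)
    refine summable_int_of_decay (C := C) fun k => ?_
    rw [fourierCoeff_eq_partialCoeff]
    exact hC t le_rfl k
  set f : ℝ → SzegoTorus → ℂ := fun t y => ((‖u t y‖ ^ 2 : ℝ) : ℂ) * u t y with hf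
  have hproj : ∀ t (m : ℤ), fourierCoeff (szegoProj (f t)) m =
      ∑' k : ℕ, if (k : ℤ) = m then fourierCoeff (f t) k else 0 := fun t m =>
    fourierCoeff_tsum (fun k : ℕ => (k : ℤ))
      ((hsum (v := f) hHs t).comp_injective Nat.cast_injective) (fun x => rfl) m
  have hderiv : ∀ t k, HasDerivAt (fun τ => fourierCoeff (u τ) k)
      (-Complex.I * fourierCoeff (szegoProj (f t)) k) t := fun t k => by
    have h := hasDerivAt_partialCoeff hGs k t
    have e : partialCoeff (fun p => fderiv ℝ G p (1, 0)) k t =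
        -Complex.I * fourierCoeff (szegoProj (f t)) k := by
      rw [← smul_eq_mul, ← fourierCoeff.const_smul,
        fourierCoeff_eq_partialCoeff (fun _ => -Complex.I • szegoProj (f t)) k t]
      simp only [partialCoeff]
      congr 1
      refine intervalIntegral.integral_congr fun x _ => ?_
      have h1 := (hasDerivAt_fst hGs (t, x)).deriv
      have h2 := hu.equation t x
      simp only [hG] at h1
      simp only [Pi.smul_apply, smul_eq_mul]
      rw [h1] at h2
      rw [← h2, ← mul_assoc (-Complex.I), neg_mul, Complex.I_mul_I, neg_neg, one_mul]
    rw [e] at h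
    refine h.congr_of_eventuallyEq (Eventually.of_forall fun τ => ?_)
    exact fourierCoeff_eq_partialCoeff u k τ
  -- The projected nonlinearity has no negative modes, so negative coefficients are constant in time
  -- and stay at their initial value `0`.
  have hneg : ∀ t, ∀ k : ℤ, k < 0 → fourierCoeff (u t) k = 0 := fun t k hk => by
    have h0 : ∀ s, fourierCoeff (szegoProj (f s)) k = 0 := fun s => by
      rw [hproj]
      have : ∀ j : ℕ, (j : ℤ) ≠ k := fun j => by omega
      simp [this]
    have := is_const_of_deriv_eq_zero (f := fun τ => fourierCoeff (u τ) k)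
      (fun s => (hderiv s k).differentiableAt) (fun s => by rw [(hderiv s k).deriv, h0, mul_zero])
      t 0
    rw [this]
    simp only [hu.initial]
    exact h₀.2 k hk
  have hpt : ∀ t x, u t x = ∑' k : ℕ, fourierCoeff (u t) (k : ℤ) * fourier (k : ℤ) x := by
    intro t x
    have hcont : Continuous (u t) := by
      refine (QuotientAddGroup.isQuotientMap_mk (N := AddSubgroup.zmultiples
        (2 * Real.pi))).continuous_iff.mpr ?_
      exact hGs.continuous.comp (by fun_prop : Continuous fun x : ℝ => (t, x))
    have hs : Summable (fourierCoeff (ContinuousMap.mk (u t) hcont)) := (hsum hGs t).of_norm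
    have := (has_pointwise_sum_fourier_series_of_summable hs x).tsum_eq
    simp only [ContinuousMap.coe_mk, smul_eq_mul] at this
    rw [← this]
    refine (Function.Injective.tsum_eq (g := ((↑) : ℕ → ℤ)) Nat.cast_injective ?_).symm
    intro k hk
    by_contra hcon
    have : k < 0 := by
      by_contra hk0
      exact hcon ⟨k.toNat, by simpa using hk0⟩
    exact hk (by simp only [hneg t k this, zero_mul])
  refine ⟨⟨fun t k => ?_, fun N T => ?_⟩, hneg⟩
  · have e : fourierCoeff (szegoProj (f t)) k = cubicCoeff (fun j => fourierCoeff (u t) j) k := by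
      rw [hproj, tsum_eq_single k (fun j hj => by simp [hj])]
      rw [if_pos rfl]
      exact fourierCoeff_cubic ((hsum hGs t).comp_injective Nat.cast_injective) (hpt t) k
    rw [← e]
    exact hderiv t k
  · obtain ⟨C, h0, hC⟩ := partialCoeff_decay N T hGs hGp
    refine ⟨C, h0, fun t ht k => ?_⟩
    have := hC t ht k
    rw [fourierCoeff_eq_partialCoeff]
    simpa using this

end

/-! ### Weighted energies and conservation laws. -/

noncomputable section

open MeasureTheory Filter Topology Set
open scoped ComplexConjugate

theorem HasSum.congr_left {ι : Type*} {f g : ι → ℂ} {a : ℂ} (h : ∀ x, g x = f x)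
    (hf : HasSum f a) : HasSum g a := (funext h : g = f) ▸ hf

namespace SzegoFlow

variable {c : ℝ → ℕ → ℂ}

theorem exists_summable_bound (h : SzegoFlow c) (N : ℕ) (T : ℝ) :
    ∃ b : ℕ → ℝ, Summable b ∧ (∀ k, 0 ≤ b k) ∧
      ∀ t, |t| ≤ T → ∀ k : ℕ, (1 + (k : ℝ)) ^ N * ‖c t k‖ ≤ b k := by
  obtain ⟨C, h0, hC⟩ := h.decay (N + 2) T
  refine ⟨fun k => C * ((1 + (k : ℝ)) ^ 2)⁻¹, summable_one_add_inv_sq.mul_left C,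
    fun k => by positivity, fun t ht k => ?_⟩
  change _ ≤ C * ((1 + (k : ℝ)) ^ 2)⁻¹
  rw [← div_eq_mul_inv, le_div_iff₀ (by positivity)]
  calc _ = (1 + (k : ℝ)) ^ (N + 2) * ‖c t k‖ := by ring
    _ ≤ C := hC t ht k

theorem summable_weight (h : SzegoFlow c) (N : ℕ) (t : ℝ) :
    Summable fun k : ℕ => (1 + (k : ℝ)) ^ N * ‖c t k‖ := by
  obtain ⟨b, hb, -, hle⟩ := h.exists_summable_bound N |t|
  exact hb.of_nonneg_of_le (fun _ => by positivity) (hle t le_rfl)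

theorem summable_norm (h : SzegoFlow c) (t : ℝ) : Summable fun k => ‖c t k‖ := by
  simpa using h.summable_weight 0 t

/-- Reversing time and conjugating maps solutions to solutions. -/
theorem reverse (h : SzegoFlow c) : SzegoFlow (fun t k => conj (c (-t) k)) where
  hasDeriv t k := by
    have h1 := (h.hasDeriv (-t) k).scomp t (hasDerivAt_neg t)
    have h2 := h1.star
    have e : cubicCoeff (fun k => conj (c (-t) k)) k = conj (cubicCoeff (c (-t)) k) := by
      rw [cubicCoeff, cubicCoeff, Complex.conj_tsum]
      refine tsum_congr fun x => ?_
      split_ifs <;> simp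
    rw [e]
    refine h2.congr_deriv ?_
    simp
  decay N T := by
    obtain ⟨C, h0, hC⟩ := h.decay N T
    exact ⟨C, h0, fun t ht k => by simpa using hC (-t) (by simpa using ht) k⟩

end SzegoFlow

/-- The resonant quartic monomial `c_i c_l conj(c_q) conj(c_k)`, `i + l = q + k`,
at the index `((i, l), (q, k))`. -/
def quartic (c : ℕ → ℂ) (x : (ℕ × ℕ) × (ℕ × ℕ)) : ℂ :=
  if x.1.1 + x.1.2 = x.2.1 + x.2.2 then
    c x.1.1 * c x.1.2 * (conj (c x.2.1) * conj (c x.2.2)) else 0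

/-- The second difference `w_q + w_k - w_i - w_l` at the index `((i, l), (q, k))`. -/
def resonantDiff (w : ℕ → ℝ) (x : (ℕ × ℕ) × (ℕ × ℕ)) : ℝ :=
  w x.2.1 + w x.2.2 - w x.1.1 - w x.1.2

theorem norm_quartic_le (c : ℕ → ℂ) (x : (ℕ × ℕ) × (ℕ × ℕ)) :
    ‖quartic c x‖ ≤ ‖c x.1.1‖ * ‖c x.1.2‖ * (‖c x.2.1‖ * ‖c x.2.2‖) := by
  unfold quartic
  split_ifs
  · simp
  · simp only [norm_zero]; positivity

theorem quartic_swap (c : ℕ → ℂ) (x : (ℕ × ℕ) × (ℕ × ℕ)) :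
    quartic c x.swap = conj (quartic c x) := by
  unfold quartic
  by_cases h : x.1.1 + x.1.2 = x.2.1 + x.2.2
  · simp [h, mul_comm]
  · simp [h, Ne.symm h]

theorem quartic_swap_snd (c : ℕ → ℂ) (x : (ℕ × ℕ) × (ℕ × ℕ)) :
    quartic c (x.1, x.2.swap) = quartic c x := by
  unfold quartic
  simp only [Prod.fst_swap, Prod.snd_swap, add_comm x.2.2, mul_comm (conj (c x.2.2))]

theorem quartic_swap_fst (c : ℕ → ℂ) (x : (ℕ × ℕ) × (ℕ × ℕ)) :
    quartic c (x.1.swap, x.2) = quartic c x := by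
  unfold quartic
  simp only [Prod.fst_swap, Prod.snd_swap, add_comm x.1.2, mul_comm (c x.1.2)]

section Sums

variable {c : ℕ → ℂ} {w : ℕ → ℝ}

theorem summable_quartic_bound (hc : Summable fun k => ‖c k‖)
    (hw : Summable fun k => |w k| * ‖c k‖) :
    Summable fun x : (ℕ × ℕ) × (ℕ × ℕ) =>
      ‖c x.1.1‖ * ‖c x.1.2‖ * (‖c x.2.1‖ * (|w x.2.2| * ‖c x.2.2‖)) := by
  have h1 := hc.mul_of_nonneg hc (fun _ => norm_nonneg _) (fun _ => norm_nonneg _)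
  have h2 := hc.mul_of_nonneg hw (fun _ => norm_nonneg _)
    (fun _ => mul_nonneg (abs_nonneg _) (norm_nonneg _))
  exact Summable.mul_of_nonneg
    (f := fun y : ℕ × ℕ => ‖c y.1‖ * ‖c y.2‖)
    (g := fun y : ℕ × ℕ => ‖c y.1‖ * (|w y.2| * ‖c y.2‖)) h1 h2
    (fun _ => by positivity) (fun _ => by positivity)

theorem norm_weight_quartic_le (x : (ℕ × ℕ) × (ℕ × ℕ)) :
    ‖(w x.2.2 : ℂ) * quartic c x‖ ≤
      ‖c x.1.1‖ * ‖c x.1.2‖ * (‖c x.2.1‖ * (|w x.2.2| * ‖c x.2.2‖)) := by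
  rw [norm_mul, Complex.norm_real, Real.norm_eq_abs]
  calc _ ≤ |w x.2.2| * (‖c x.1.1‖ * ‖c x.1.2‖ * (‖c x.2.1‖ * ‖c x.2.2‖)) :=
        mul_le_mul_of_nonneg_left (norm_quartic_le c x) (abs_nonneg _)
    _ = _ := by ring

theorem summable_weight_quartic (hc : Summable fun k => ‖c k‖)
    (hw : Summable fun k => |w k| * ‖c k‖) :
    Summable fun x => (w x.2.2 : ℂ) * quartic c x :=
  (summable_quartic_bound hc hw).of_norm_bounded norm_weight_quartic_le

theorem hasSum_weight_quartic (hc : Summable fun k => ‖c k‖)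
    (hw : Summable fun k => |w k| * ‖c k‖) :
    HasSum (fun k => (w k : ℂ) * (conj (c k) * cubicCoeff c k))
      (∑' x, (w x.2.2 : ℂ) * quartic c x) := by
  have hs := summable_weight_quartic hc hw
  have h1 := (Equiv.prodAssoc (ℕ × ℕ) ℕ ℕ).hasSum_iff.mpr hs.hasSum
  have h2 := (Equiv.prodComm ℕ ((ℕ × ℕ) × ℕ)).hasSum_iff.mpr h1
  have h3 : ∀ k : ℕ, HasSum (fun y : (ℕ × ℕ) × ℕ =>
      (w k : ℂ) * quartic c (y.1, (y.2, k))) ((w k : ℂ) * (conj (c k) * cubicCoeff c k)) := by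
    intro k
    have hk : HasSum _ _ := (h2.summable.prod_factor k).hasSum
    have e : (w k : ℂ) * (conj (c k) * cubicCoeff c k) =
        ∑' y : (ℕ × ℕ) × ℕ, (w k : ℂ) * quartic c (y.1, (y.2, k)) := by
      rw [tsum_mul_left, cubicCoeff, ← tsum_mul_left]
      congr 1
      refine tsum_congr fun y => ?_
      unfold quartic
      split_ifs
      · ring
      · rw [mul_zero]
    rw [e]
    exact hk
  exact h2.prod_fiberwise h3

/-- The weight may be moved to any of the four slots: swaps inside a pair fix the monomial, and
exchanging the pairs conjugates it. Adding the four versions with signs gives `2S - 2 conj S`, whose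
imaginary part is `4 Im S`. -/
theorem two_mul_im_tsum_quartic (hc : Summable fun k => ‖c k‖)
    (hw : Summable fun k => |w k| * ‖c k‖) :
    2 * (∑' x, (w x.2.2 : ℂ) * quartic c x).im =
      1 / 2 * (∑' x, (resonantDiff w x : ℂ) * quartic c x).im ∧
    Summable fun x => (resonantDiff w x : ℂ) * quartic c x := by
  have hk := summable_weight_quartic hc hw
  let e2 : (ℕ × ℕ) × (ℕ × ℕ) ≃ (ℕ × ℕ) × (ℕ × ℕ) :=
    (Equiv.refl _).prodCongr (Equiv.prodComm ℕ ℕ)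
  let e1 : (ℕ × ℕ) × (ℕ × ℕ) ≃ (ℕ × ℕ) × (ℕ × ℕ) :=
    (Equiv.prodComm ℕ ℕ).prodCongr (Equiv.refl _)
  let es : (ℕ × ℕ) × (ℕ × ℕ) ≃ (ℕ × ℕ) × (ℕ × ℕ) := Equiv.prodComm _ _
  set S := ∑' x, (w x.2.2 : ℂ) * quartic c x with hS
  have Hk : HasSum (fun x => (w x.2.2 : ℂ) * quartic c x) S := hk.hasSum
  have Hq : HasSum (fun x => (w x.2.1 : ℂ) * quartic c x) S := by
    refine HasSum.congr_left (fun x => ?_) (e2.hasSum_iff.mpr Hk)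
    rw [← quartic_swap_snd]
    rfl
  have Hl : HasSum (fun x => (w x.1.2 : ℂ) * quartic c x) (conj S) := by
    refine HasSum.congr_left (fun x => ?_) (Complex.hasSum_conj'.mpr (es.hasSum_iff.mpr Hk))
    change _ = conj ((w x.1.2 : ℂ) * quartic c x.swap)
    rw [quartic_swap, map_mul, Complex.conj_conj, Complex.conj_ofReal]
  have Hi : HasSum (fun x => (w x.1.1 : ℂ) * quartic c x) (conj S) := by
    refine HasSum.congr_left (fun x => ?_) (e1.hasSum_iff.mpr Hl)
    rw [← quartic_swap_fst]
    rfl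
  have H' : HasSum (fun x => (resonantDiff w x : ℂ) * quartic c x)
      (S + S - conj S - conj S) := by
    refine HasSum.congr_left (fun x => ?_) (((Hq.add Hk).sub Hi).sub Hl)
    rw [resonantDiff]
    push_cast
    ring
  refine ⟨?_, H'.summable⟩
  rw [H'.tsum_eq]
  simp
  ring

theorem norm_cubicCoeff_le (hc : Summable fun k => ‖c k‖) (m : ℕ) :
    ‖cubicCoeff c m‖ ≤ (∑' k, ‖c k‖) ^ 3 := by
  have h2 := hc.mul_of_nonneg hc (fun _ => norm_nonneg _) (fun _ => norm_nonneg _)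
  have h3 := Summable.mul_of_nonneg (f := fun y : ℕ × ℕ => ‖c y.1‖ * ‖c y.2‖)
    (g := fun k => ‖c k‖) h2 hc (fun _ => by positivity) (fun _ => norm_nonneg _)
  have e : ∑' x : (ℕ × ℕ) × ℕ, ‖c x.1.1‖ * ‖c x.1.2‖ * ‖c x.2‖ = (∑' k, ‖c k‖) ^ 3 := by
    rw [pow_succ, pow_two, hc.tsum_mul_tsum hc h2]
    exact (Summable.tsum_mul_tsum (f := fun y : ℕ × ℕ => ‖c y.1‖ * ‖c y.2‖)
      (g := fun k => ‖c k‖) h2 hc h3).symm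
  rw [← e]
  refine tsum_of_norm_bounded h3.hasSum fun x => ?_
  split_ifs
  · simp
  · simp only [norm_zero]; positivity

end Sums

namespace SzegoFlow

variable {c : ℝ → ℕ → ℂ}

theorem summable_abs_weight (h : SzegoFlow c) {w : ℕ → ℝ} {N : ℕ} {K : ℝ}
    (hw : ∀ k : ℕ, |w k| ≤ K * (1 + (k : ℝ)) ^ N) (t : ℝ) :
    Summable fun k => |w k| * ‖c t k‖ := by
  refine ((h.summable_weight N t).mul_left K).of_nonneg_of_le (fun _ => by positivity) fun k => ?_
  rw [← mul_assoc]
  exact mul_le_mul_of_nonneg_right (hw k) (norm_nonneg _)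

theorem summable_energy (h : SzegoFlow c) {w : ℕ → ℝ} {N : ℕ} {K : ℝ}
    (hw : ∀ k : ℕ, |w k| ≤ K * (1 + (k : ℝ)) ^ N) (t : ℝ) :
    Summable fun k => w k * ‖c t k‖ ^ 2 := by
  obtain ⟨C, h0, hC⟩ := h.decay 0 |t|
  refine ((h.summable_abs_weight hw t).mul_right C).of_norm_bounded fun k => ?_
  have := hC t le_rfl k
  rw [pow_zero, one_mul] at this
  rw [norm_mul, norm_pow, norm_norm, Real.norm_eq_abs, pow_two, ← mul_assoc]
  gcongr

theorem hasDerivAt_energy (h : SzegoFlow c) {w : ℕ → ℝ} {N : ℕ} {K : ℝ}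
    (hw : ∀ k : ℕ, |w k| ≤ K * (1 + (k : ℝ)) ^ N) (t : ℝ) :
    HasDerivAt (fun τ => ∑' k, w k * ‖c τ k‖ ^ 2)
      (1 / 2 * (∑' x, (resonantDiff w x : ℂ) * quartic (c t) x).im) t := by
  have hc := h.summable_norm t
  have hwc := h.summable_abs_weight hw t
  obtain ⟨b, hb, hb0, hbN⟩ := h.exists_summable_bound N (|t| + 1)
  obtain ⟨b₀, hb₀, hb₀0, hb₀N⟩ := h.exists_summable_bound 0 (|t| + 1)
  have hK : 0 ≤ K := by
    have := (abs_nonneg _).trans (hw 0)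
    simpa using this
  have hball : ∀ τ ∈ Metric.ball t 1, |τ| ≤ |t| + 1 := fun τ hτ => by
    rw [Metric.mem_ball, Real.dist_eq] at hτ
    linarith [abs_sub_abs_le_abs_sub τ t]
  -- Termwise differentiation on the unit ball around `t`. The majorant combines `|w_k| |c_k| ≤ K
  -- b_k` with the bound `(Σ b₀)³` for the cubic term.
  have key := hasDerivAt_tsum_of_isPreconnected (𝕜 := ℝ)
    (u := fun k => K * b k * (2 * (∑' j, b₀ j) ^ 3))
    (g := fun k τ => w k * ‖c τ k‖ ^ 2)
    (g' := fun k τ => w k * (2 * inner ℝ (c τ k) (-Complex.I * cubicCoeff (c τ) k)))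
    (t := Metric.ball t 1) (y := t) (y₀ := t) ((hb.mul_left K).mul_right _) Metric.isOpen_ball
    (convex_ball t 1).isPreconnected (fun k τ _ => (h.hasDeriv τ k).norm_sq.const_mul _)
    (fun k τ hτ => ?_) (Metric.mem_ball_self one_pos) (h.summable_energy hw t)
    (Metric.mem_ball_self one_pos)
  · refine key.congr_deriv ?_
    rw [← (two_mul_im_tsum_quartic hc hwc).1,
      ← (Complex.hasSum_im (hasSum_weight_quartic hc hwc)).tsum_eq, ← tsum_mul_left]
    refine tsum_congr fun k => ?_
    rw [Complex.inner]
    simp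
    ring
  · have e1 : ‖cubicCoeff (c τ) k‖ ≤ (∑' j, b₀ j) ^ 3 := by
      refine (norm_cubicCoeff_le (h.summable_norm τ) k).trans ?_
      refine pow_le_pow_left₀ (tsum_nonneg fun _ => norm_nonneg _)
        (Summable.tsum_le_tsum (fun j => ?_) (h.summable_norm τ) hb₀) 3
      simpa using hb₀N τ (hball τ hτ) j
    have e2 := abs_real_inner_le_norm (c τ k) (-Complex.I * cubicCoeff (c τ) k)
    rw [norm_mul, norm_neg, Complex.norm_I, one_mul] at e2
    rw [Real.norm_eq_abs, abs_mul, abs_mul, abs_of_pos (two_pos : (0 : ℝ) < 2)]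
    have hS : 0 ≤ (∑' j, b₀ j) ^ 3 := pow_nonneg (tsum_nonneg hb₀0) 3
    calc _ ≤ (K * (1 + (k : ℝ)) ^ N) * (2 * (‖c τ k‖ * (∑' j, b₀ j) ^ 3)) := by
          gcongr
          · exact hw k
          · exact e2.trans (by gcongr)
      _ = K * ((1 + (k : ℝ)) ^ N * ‖c τ k‖) * (2 * (∑' j, b₀ j) ^ 3) := by ring
      _ ≤ _ := by
          gcongr
          exact hbN τ (hball τ hτ) k

/-- A weight with vanishing resonant second differences gives a conserved quantity. -/
theorem energy_const (h : SzegoFlow c) {w : ℕ → ℝ} {N : ℕ} {K : ℝ}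
    (hw : ∀ k : ℕ, |w k| ≤ K * (1 + (k : ℝ)) ^ N)
    (hz : ∀ i l q k, i + l = q + k → w q + w k - w i - w l = 0) (t : ℝ) :
    ∑' k, w k * ‖c t k‖ ^ 2 = ∑' k, w k * ‖c 0 k‖ ^ 2 := by
  refine is_const_of_deriv_eq_zero (f := fun τ => ∑' k, w k * ‖c τ k‖ ^ 2)
    (fun s => (h.hasDerivAt_energy hw s).differentiableAt) (fun s => ?_) t 0
  rw [(h.hasDerivAt_energy hw s).deriv]
  have : ∀ x, (resonantDiff w x : ℂ) * quartic (c s) x = 0 := fun x => by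
    unfold quartic
    split_ifs with hx
    · rw [resonantDiff, hz _ _ _ _ hx]; simp
    · rw [mul_zero]
  simp [this]

/-- The weight `1 + k` is affine, so its resonant differences vanish; this is mass plus momentum. -/
theorem halfNorm_const (h : SzegoFlow c) (t : ℝ) :
    ∑' k : ℕ, (1 + (k : ℝ)) * ‖c t k‖ ^ 2 = ∑' k : ℕ, (1 + (k : ℝ)) * ‖c 0 k‖ ^ 2 := by
  refine h.energy_const (w := fun k : ℕ => 1 + (k : ℝ)) (N := 1) (K := 1) (fun k => ?_)
    (fun i l q k hx => ?_) t
  · rw [one_mul, pow_one, abs_of_nonneg (by positivity)]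
  · have : (i : ℝ) + l = q + k := by exact_mod_cast hx
    linarith

end SzegoFlow
end

/-! ### Resonant differences of the Sobolev weight and counting of resonances. -/

noncomputable section

open MeasureTheory Filter Topology Set
open scoped ComplexConjugate ENNReal

theorem pow_succ_sub_pow_succ_le {a b : ℝ} (hb : 0 ≤ b) (hab : b ≤ a) (n : ℕ) :
    a ^ (n + 1) - b ^ (n + 1) ≤ (n + 1) * a ^ n * (a - b) := by
  induction n with
  | zero => simp
  | succ n ih =>
    have h1 : b ^ (n + 1) ≤ a ^ (n + 1) := pow_le_pow_left₀ hb hab _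
    have h2 := mul_le_mul_of_nonneg_left ih (hb.trans hab)
    have h3 := mul_le_mul_of_nonneg_right h1 (sub_nonneg.mpr hab)
    push_cast
    calc a ^ (n + 1 + 1) - b ^ (n + 1 + 1)
        = a * (a ^ (n + 1) - b ^ (n + 1)) + b ^ (n + 1) * (a - b) := by ring
      _ ≤ a * ((n + 1) * a ^ n * (a - b)) + a ^ (n + 1) * (a - b) := add_le_add h2 h3
      _ = _ := by ring

/-- The weight `(1 + k²)^(n+1)` of the squared `H^{1+n}` norm. -/
def sobolevWeight (n k : ℕ) : ℝ := (1 + (k : ℝ) ^ 2) ^ (n + 1)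

theorem sobolevWeight_mono (n : ℕ) {q i : ℕ} (h : q ≤ i) :
    sobolevWeight n q ≤ sobolevWeight n i := by
  unfold sobolevWeight
  gcongr

theorem sobolevWeight_nonneg (n k : ℕ) : 0 ≤ sobolevWeight n k := by
  unfold sobolevWeight; positivity

theorem sobolevWeight_sub_le (n : ℕ) {q i : ℕ} (h : q ≤ i) :
    sobolevWeight n i - sobolevWeight n q ≤
      2 * (n + 1) * ((i : ℝ) - q) * (1 + (i : ℝ)) ^ (2 * n + 1) := by
  have hqi : (q : ℝ) ≤ i := by exact_mod_cast h
  have hq : (0 : ℝ) ≤ q := by positivity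
  have h1 : 1 + (i : ℝ) ^ 2 ≤ (1 + (i : ℝ)) ^ 2 := by nlinarith
  have h2 : (1 + (i : ℝ) ^ 2) ^ n ≤ (1 + (i : ℝ)) ^ (2 * n) := by
    rw [pow_mul]; exact pow_le_pow_left₀ (by positivity) h1 n
  have h3 : (1 + (i : ℝ) ^ 2) - (1 + (q : ℝ) ^ 2) ≤ ((i : ℝ) - q) * (2 * (1 + i)) := by
    nlinarith
  calc _ ≤ (n + 1) * (1 + (i : ℝ) ^ 2) ^ n * ((1 + (i : ℝ) ^ 2) - (1 + (q : ℝ) ^ 2)) :=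
        pow_succ_sub_pow_succ_le (by positivity) (by gcongr) n
    _ ≤ (n + 1) * (1 + (i : ℝ)) ^ (2 * n) * (((i : ℝ) - q) * (2 * (1 + i))) := by
        refine mul_le_mul (by gcongr) h3 ?_ (by positivity)
        have : (q : ℝ) ^ 2 ≤ (i : ℝ) ^ 2 := by gcongr
        linarith
    _ = _ := by ring

/-- The constant in the bound on resonant differences of the Sobolev weight. -/
def diffConst (n : ℕ) : ℝ := 2 * (n + 1) * 2 ^ (n + 1)

/-- The resonant difference is `(w_k - w_l) - (w_i - w_q)`, two nonnegative increments over gaps of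
equal length `k - l ≤ k`; each obeys the same mean value bound, hence so does their difference.
Since `i ≤ q + k ≤ 2q`, half of the powers of `1 + i` can be moved to `1 + q`. -/
theorem abs_resonantDiff_le (n : ℕ) {i l q k : ℕ} (hr : i + l = q + k) (hlk : l ≤ k)
    (hkq : k ≤ q) (hqi : q ≤ i) :
    |resonantDiff (sobolevWeight n) ((i, l), (q, k))| * (1 + (i : ℝ)) ≤
      diffConst n * k * ((1 + (i : ℝ)) ^ (n + 1) * (1 + (q : ℝ)) ^ (n + 1)) := by
  have hr' : (i : ℝ) + l = q + k := by exact_mod_cast hr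
  have hki : (k : ℝ) ≤ i := by exact_mod_cast hkq.trans hqi
  have hkq' : (k : ℝ) ≤ q := by exact_mod_cast hkq
  have hl : (0 : ℝ) ≤ l := by positivity
  have h1 := sobolevWeight_sub_le n hqi
  have h2 := sobolevWeight_sub_le n hlk
  have m1 := sobolevWeight_mono n hqi
  have m2 := sobolevWeight_mono n hlk
  have b1 : 2 * (n + 1) * ((i : ℝ) - q) * (1 + (i : ℝ)) ^ (2 * n + 1) ≤
      2 * (n + 1) * k * (1 + (i : ℝ)) ^ (2 * n + 1) := by
    gcongr; linarith
  have b2 : 2 * (n + 1) * ((k : ℝ) - l) * (1 + (k : ℝ)) ^ (2 * n + 1) ≤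
      2 * (n + 1) * k * (1 + (i : ℝ)) ^ (2 * n + 1) := by
    gcongr; linarith
  have b3 : |resonantDiff (sobolevWeight n) ((i, l), (q, k))| ≤
      2 * (n + 1) * k * (1 + (i : ℝ)) ^ (2 * n + 1) := by
    rw [abs_le, resonantDiff]
    constructor <;> simp only <;> linarith
  have b4 : (1 + (i : ℝ)) ^ (n + 1) ≤ 2 ^ (n + 1) * (1 + (q : ℝ)) ^ (n + 1) := by
    rw [← mul_pow]
    gcongr; linarith
  calc _ ≤ 2 * (n + 1) * k * (1 + (i : ℝ)) ^ (2 * n + 1) * (1 + (i : ℝ)) := by gcongr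
    _ = 2 * (n + 1) * k * ((1 + (i : ℝ)) ^ (n + 1) * (1 + (i : ℝ)) ^ (n + 1)) := by ring
    _ ≤ 2 * (n + 1) * k * ((1 + (i : ℝ)) ^ (n + 1) * (2 ^ (n + 1) * (1 + (q : ℝ)) ^ (n + 1))) := by
        gcongr
    _ = _ := by rw [diffConst]; ring

/-- The set `p` and its preimage under `e` cover `X` and carry the same sum. -/
theorem ENNReal.tsum_le_two_mul_of_invariant {X : Type*} (e : X ≃ X) {g : X → ℝ≥0∞}
    (hg : ∀ x, g (e x) = g x) (p : X → Prop) [DecidablePred p] (hp : ∀ x, p x ∨ p (e x)) :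
    ∑' x, g x ≤ 2 * ∑' x, if p x then g x else 0 := by
  have h1 : ∀ x, g x ≤ (if p x then g x else 0) + if p (e x) then g (e x) else 0 := fun x => by
    rcases hp x with h | h
    · rw [if_pos h]; exact le_self_add
    · rw [if_pos h, hg]; exact le_add_self
  refine (ENNReal.tsum_le_tsum h1).trans ?_
  rw [ENNReal.tsum_add, e.tsum_eq (fun x => if p x then g x else 0), two_mul]

theorem ENNReal.tsum_ite_add_eq_le (m k : ℕ) (r : ℝ≥0∞) :
    ∑' q : ℕ, (if m = q + k then r else 0) ≤ r := by
  by_cases h : k ≤ m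
  · rw [tsum_eq_single (m - k) (fun q hq => if_neg (by omega))]
    split_ifs <;> simp
  · have : ∀ q : ℕ, ¬ m = q + k := fun q => by omega
    simp [this]

/-- Given `i`, `l`, `k`, the resonance leaves at most one `q`. -/
theorem ENNReal.tsum_resonant_le (α β γ : ℕ → ℝ≥0∞) :
    ∑' x : (ℕ × ℕ) × (ℕ × ℕ), (if x.1.1 + x.1.2 = x.2.1 + x.2.2 then
      α x.1.1 * β x.1.2 * γ x.2.2 else 0) ≤ (∑' i, α i) * (∑' l, β l) * ∑' k, γ k := by
  rw [ENNReal.tsum_prod']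
  have h1 : ∀ y : ℕ × ℕ, ∑' z : ℕ × ℕ, (if y.1 + y.2 = z.1 + z.2 then
      α y.1 * β y.2 * γ z.2 else 0) ≤ α y.1 * β y.2 * ∑' k, γ k := fun y => by
    rw [ENNReal.tsum_prod', ENNReal.tsum_comm, ← ENNReal.tsum_mul_left]
    exact ENNReal.tsum_le_tsum fun k => ENNReal.tsum_ite_add_eq_le _ _ _
  refine (ENNReal.tsum_le_tsum h1).trans ?_
  rw [ENNReal.tsum_mul_right, ENNReal.tsum_prod']
  simp_rw [ENNReal.tsum_mul_left]
  rw [ENNReal.tsum_mul_right]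

/-- Given `i`, `l`, `q`, the resonance leaves at most one `k`, and the window `[q, 2q]` contains
exactly `q + 1` values of `i`, which cancel the weight `(q + 1)⁻¹`. No logarithm is lost here. -/
theorem ENNReal.tsum_resonant_window_le (β δ : ℕ → ℝ≥0∞) :
    ∑' x : (ℕ × ℕ) × (ℕ × ℕ), (if x.1.1 + x.1.2 = x.2.1 + x.2.2 ∧
      x.1.1 ∈ Finset.Icc x.2.1 (2 * x.2.1) then
      β x.1.2 * (δ x.2.1 * ((x.2.1 : ℝ≥0∞) + 1)⁻¹) else 0) ≤ (∑' l, β l) * ∑' q, δ q := by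
  have h1 : ∀ y : ℕ × ℕ, ∑' z : ℕ × ℕ, (if y.1 + y.2 = z.1 + z.2 ∧
      y.1 ∈ Finset.Icc z.1 (2 * z.1) then β y.2 * (δ z.1 * ((z.1 : ℝ≥0∞) + 1)⁻¹) else 0) ≤
      ∑' q, if y.1 ∈ Finset.Icc q (2 * q) then β y.2 * (δ q * ((q : ℝ≥0∞) + 1)⁻¹) else 0 := by
    intro y
    rw [ENNReal.tsum_prod']
    refine ENNReal.tsum_le_tsum fun q => ?_
    simp only
    by_cases hq : y.1 ∈ Finset.Icc q (2 * q)
    · simp only [hq, and_true, if_true]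
      simp_rw [add_comm q]
      exact ENNReal.tsum_ite_add_eq_le _ _ _
    · simp [hq]
  have h2 : ∀ q : ℕ, ∑' i : ℕ, (if i ∈ Finset.Icc q (2 * q) then
      δ q * ((q : ℝ≥0∞) + 1)⁻¹ else 0) ≤ δ q := fun q => by
    rw [tsum_eq_sum (s := Finset.Icc q (2 * q)) (fun i hi => if_neg hi),
      Finset.sum_ite_mem, Finset.inter_self, Finset.sum_const, Nat.card_Icc, nsmul_eq_mul]
    have : ((2 * q + 1 - q : ℕ) : ℝ≥0∞) = (q : ℝ≥0∞) + 1 := by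
      rw [show 2 * q + 1 - q = q + 1 by omega]; push_cast; rfl
    rw [this, mul_left_comm, ENNReal.mul_inv_cancel (by simp) (by simp), mul_one]
  rw [ENNReal.tsum_prod']
  refine (ENNReal.tsum_le_tsum h1).trans ?_
  rw [ENNReal.tsum_prod', ENNReal.tsum_comm, ← ENNReal.tsum_mul_right]
  refine ENNReal.tsum_le_tsum fun l => ?_
  rw [ENNReal.tsum_comm, ← ENNReal.tsum_mul_left]
  refine ENNReal.tsum_le_tsum fun q => ?_
  refine le_trans (le_of_eq ?_) (mul_le_mul_right (h2 q) (β l))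
  rw [← ENNReal.tsum_mul_left]
  simp only [mul_ite, mul_zero]

end

/-! ### The energy estimate, linear in the `ℓ¹` norm. -/

noncomputable section

open MeasureTheory Filter Topology Set
open scoped ComplexConjugate ENNReal

theorem abs_resonantDiff_mul_norm_quartic_le (c : ℕ → ℂ) (n : ℕ) {μ : ℝ} (hμ : 0 < μ)
    {i l q k : ℕ} (hr : i + l = q + k) (hlk : l ≤ k) (hkq : k ≤ q) (hqi : q ≤ i) :
    |resonantDiff (sobolevWeight n) ((i, l), (q, k))| * ‖quartic c ((i, l), (q, k))‖ ≤
      diffConst n / 2 * μ⁻¹ * (((1 + (i : ℝ)) ^ (n + 1) * ‖c i‖) ^ 2 * ‖c l‖ *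
        ((1 + (k : ℝ)) * ‖c k‖ ^ 2)) +
      diffConst n / 2 * μ * (‖c l‖ * (((1 + (q : ℝ)) ^ (n + 1) * ‖c q‖) ^ 2 * ((q : ℝ) + 1)⁻¹)) := by
  have hD : 0 ≤ diffConst n := by unfold diffConst; positivity
  have hi : (0 : ℝ) < 1 + i := by positivity
  set P := (1 + (i : ℝ)) ^ (n + 1) * ‖c i‖ with hP
  set R := (1 + (q : ℝ)) ^ (n + 1) * ‖c q‖ with hR
  have h0 := abs_resonantDiff_le n hr hlk hkq hqi
  have h1 : |resonantDiff (sobolevWeight n) ((i, l), (q, k))| ≤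
      diffConst n * k * ((1 + (i : ℝ)) ^ (n + 1) * (1 + (q : ℝ)) ^ (n + 1)) * (1 + (i : ℝ))⁻¹ := by
    rwa [← div_eq_mul_inv, le_div_iff₀ hi]
  have h2 := norm_quartic_le c ((i, l), (q, k))
  simp only at h2
  -- This produces the factor `(q + 1)⁻¹` that later pays for the sum over `i` in `[q, 2q]`.
  have hk : (k : ℝ) * (1 + (i : ℝ))⁻¹ ^ 2 ≤ ((q : ℝ) + 1)⁻¹ := by
    have hkq' : (k : ℝ) ≤ 1 + i := by
      have : (k : ℝ) ≤ i := by exact_mod_cast hkq.trans hqi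
      linarith
    have hqi' : (q : ℝ) + 1 ≤ 1 + i := by
      have : (q : ℝ) ≤ i := by exact_mod_cast hqi
      linarith
    calc _ ≤ (1 + (i : ℝ)) * (1 + (i : ℝ))⁻¹ ^ 2 := by gcongr
      _ = (1 + (i : ℝ))⁻¹ := by field_simp
      _ ≤ _ := by gcongr
  have amgm : 2 * (P * ‖c k‖ * (R * (1 + (i : ℝ))⁻¹)) ≤
      μ⁻¹ * (P * ‖c k‖) ^ 2 + μ * (R * (1 + (i : ℝ))⁻¹) ^ 2 := by
    have := mul_nonneg (inv_pos.mpr hμ).le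
      (sq_nonneg (P * ‖c k‖ - μ * (R * (1 + (i : ℝ))⁻¹)))
    have e : μ⁻¹ * (P * ‖c k‖ - μ * (R * (1 + (i : ℝ))⁻¹)) ^ 2 = μ⁻¹ * (P * ‖c k‖) ^ 2 +
        μ * (R * (1 + (i : ℝ))⁻¹) ^ 2 - 2 * (P * ‖c k‖ * (R * (1 + (i : ℝ))⁻¹)) := by
      field_simp; ring
    linarith
  calc _ ≤ (diffConst n * k * ((1 + (i : ℝ)) ^ (n + 1) * (1 + (q : ℝ)) ^ (n + 1)) *
        (1 + (i : ℝ))⁻¹) * (‖c i‖ * ‖c l‖ * (‖c q‖ * ‖c k‖)) := by gcongr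
    _ = diffConst n / 2 * ‖c l‖ * k * (2 * (P * ‖c k‖ * (R * (1 + (i : ℝ))⁻¹))) := by
        rw [hP, hR]; ring
    _ ≤ diffConst n / 2 * ‖c l‖ * k *
        (μ⁻¹ * (P * ‖c k‖) ^ 2 + μ * (R * (1 + (i : ℝ))⁻¹) ^ 2) := by gcongr
    _ = diffConst n / 2 * μ⁻¹ * (P ^ 2 * ‖c l‖ * (k * ‖c k‖ ^ 2)) +
        diffConst n / 2 * μ * (‖c l‖ * (R ^ 2 * (k * (1 + (i : ℝ))⁻¹ ^ 2))) := by ring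
    _ ≤ _ := by
        gcongr
        linarith

theorem resonantDiff_swap_fst (w : ℕ → ℝ) (x : (ℕ × ℕ) × (ℕ × ℕ)) :
    resonantDiff w (x.1.swap, x.2) = resonantDiff w x := by
  simp only [resonantDiff, Prod.fst_swap, Prod.snd_swap]; ring

theorem resonantDiff_swap_snd (w : ℕ → ℝ) (x : (ℕ × ℕ) × (ℕ × ℕ)) :
    resonantDiff w (x.1, x.2.swap) = resonantDiff w x := by
  simp only [resonantDiff, Prod.fst_swap, Prod.snd_swap]; ring

theorem resonantDiff_swap (w : ℕ → ℝ) (x : (ℕ × ℕ) × (ℕ × ℕ)) :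
    resonantDiff w x.swap = -resonantDiff w x := by
  simp only [resonantDiff, Prod.fst_swap, Prod.snd_swap]; ring

/-- Sums of resonant interactions reduce to ordered frequencies. -/
theorem tsum_resonantDiff_le_ordered (c : ℕ → ℂ) (w : ℕ → ℝ) :
    ∑' x, ENNReal.ofReal (|resonantDiff w x| * ‖quartic c x‖) ≤
      8 * ∑' x : (ℕ × ℕ) × (ℕ × ℕ), if x.2.1 ≤ x.1.1 then if x.2.2 ≤ x.2.1 then
        if x.1.2 ≤ x.1.1 then ENNReal.ofReal (|resonantDiff w x| * ‖quartic c x‖)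
        else 0 else 0 else 0 := by
  set g : (ℕ × ℕ) × (ℕ × ℕ) → ℝ≥0∞ :=
    fun x => ENNReal.ofReal (|resonantDiff w x| * ‖quartic c x‖) with hg
  let e1 : (ℕ × ℕ) × (ℕ × ℕ) ≃ (ℕ × ℕ) × (ℕ × ℕ) :=
    (Equiv.prodComm ℕ ℕ).prodCongr (Equiv.refl _)
  let e2 : (ℕ × ℕ) × (ℕ × ℕ) ≃ (ℕ × ℕ) × (ℕ × ℕ) :=
    (Equiv.refl _).prodCongr (Equiv.prodComm ℕ ℕ)
  have g1 : ∀ x : (ℕ × ℕ) × (ℕ × ℕ), g (x.1.swap, x.2) = g x := fun x => by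
    simp only [hg]; rw [resonantDiff_swap_fst, quartic_swap_fst]
  have g2 : ∀ x : (ℕ × ℕ) × (ℕ × ℕ), g (x.1, x.2.swap) = g x := fun x => by
    simp only [hg]; rw [resonantDiff_swap_snd, quartic_swap_snd]
  have g3 : ∀ x : (ℕ × ℕ) × (ℕ × ℕ), g x.swap = g x := fun x => by
    simp only [hg]; rw [resonantDiff_swap, quartic_swap, abs_neg, RCLike.norm_conj]
  have s1 := ENNReal.tsum_le_two_mul_of_invariant e1 (g := g) g1 (fun x => x.1.2 ≤ x.1.1)
    (fun x => le_total _ _)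
  have s2 := ENNReal.tsum_le_two_mul_of_invariant e2
    (g := fun x => if x.1.2 ≤ x.1.1 then g x else 0)
    (fun x => if_congr Iff.rfl (g2 x) rfl) (fun x => x.2.2 ≤ x.2.1)
    (fun x => le_total _ _)
  have s3 := ENNReal.tsum_le_two_mul_of_invariant (Equiv.prodComm (ℕ × ℕ) (ℕ × ℕ))
    (g := fun x => if x.2.2 ≤ x.2.1 then if x.1.2 ≤ x.1.1 then g x else 0 else 0)
    (fun x => by
      change (if x.1.2 ≤ x.1.1 then if x.2.2 ≤ x.2.1 then g x.swap else 0 else 0) = _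
      rw [g3]
      split_ifs <;> rfl) (fun x => x.2.1 ≤ x.1.1) (fun x => le_total _ _)
  calc _ ≤ 2 * (2 * (2 * _)) := s1.trans (mul_le_mul_right (s2.trans (mul_le_mul_right s3 2)) 2)
    _ = _ := by
      rw [← mul_assoc, ← mul_assoc, show (2 : ℝ≥0∞) * 2 * 2 = 8 by norm_num]

theorem sobolevWeight_ge (n k : ℕ) :
    ((1 + (k : ℝ)) ^ (n + 1)) ^ 2 ≤ 2 ^ (n + 1) * sobolevWeight n k := by
  rw [sobolevWeight, ← mul_pow, ← pow_mul, mul_comm (n + 1), pow_mul]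
  refine pow_le_pow_left₀ (by positivity) ?_ _
  nlinarith [sq_nonneg ((k : ℝ) - 1)]

/-- The growth constant in the energy estimate. -/
def energyConst (n : ℕ) : ℝ := 8 * diffConst n * 2 ^ (n + 1)

theorem energyConst_pos (n : ℕ) : 0 < energyConst n := by
  unfold energyConst diffConst; positivity

/-- The weighted AM-GM splits each ordered term in two. The first part sums to `μ⁻¹` times the
half-norm, hence at most `μ`, and the second carries `μ` directly, so the two are balanced. Sums are
taken in `ℝ≥0∞` so that they can be reordered freely. -/
theorem tsum_resonantDiff_quartic_le {c : ℕ → ℂ} {n : ℕ} {μ : ℝ} (hμ : 0 < μ)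
    (hc : Summable fun k => ‖c k‖)
    (hQ : Summable fun k : ℕ => (1 + (k : ℝ)) * ‖c k‖ ^ 2)
    (hQμ : ∑' k : ℕ, (1 + (k : ℝ)) * ‖c k‖ ^ 2 ≤ μ ^ 2)
    (hF : Summable fun k => sobolevWeight n k * ‖c k‖ ^ 2)
    (hs : Summable fun x => (resonantDiff (sobolevWeight n) x : ℂ) * quartic c x) :
    |(∑' x, (resonantDiff (sobolevWeight n) x : ℂ) * quartic c x).im| ≤
      energyConst n * μ * (∑' k, ‖c k‖) * ∑' k, sobolevWeight n k * ‖c k‖ ^ 2 := by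
  have hD : 0 ≤ diffConst n := by unfold diffConst; positivity
  set w := sobolevWeight n
  set V : ℕ → ℝ := fun j => ((1 + (j : ℝ)) ^ (n + 1) * ‖c j‖) ^ 2 with hV
  have hVle : ∀ j, V j ≤ 2 ^ (n + 1) * (w j * ‖c j‖ ^ 2) := fun j => by
    simp only [hV]
    rw [mul_pow, ← mul_assoc]
    exact mul_le_mul_of_nonneg_right (sobolevWeight_ge n j) (by positivity)
  have hVs : Summable V := (hF.mul_left _).of_nonneg_of_le (fun _ => by positivity) hVle
  have hVF : ∑' j, V j ≤ 2 ^ (n + 1) * ∑' k, w k * ‖c k‖ ^ 2 := by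
    rw [← tsum_mul_left]; exact hVs.tsum_le_tsum hVle (hF.mul_left _)
  set S := ∑' k, ‖c k‖ with hS
  have hS0 : 0 ≤ S := tsum_nonneg fun _ => norm_nonneg _
  have hV0 : 0 ≤ ∑' j, V j := tsum_nonneg fun _ => by positivity
  set E₁ := diffConst n / 2 * μ⁻¹ with hE₁
  set E₂ := diffConst n / 2 * μ with hE₂
  have hE₁0 : 0 ≤ E₁ := by positivity
  have hE₂0 : 0 ≤ E₂ := by positivity
  clear_value E₁ E₂
  have hpt : ∀ x : (ℕ × ℕ) × (ℕ × ℕ), (if x.2.1 ≤ x.1.1 then if x.2.2 ≤ x.2.1 then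
        if x.1.2 ≤ x.1.1 then ENNReal.ofReal (|resonantDiff w x| * ‖quartic c x‖)
        else 0 else 0 else 0) ≤
      ENNReal.ofReal E₁ * (if x.1.1 + x.1.2 = x.2.1 + x.2.2 then ENNReal.ofReal (V x.1.1) *
        ENNReal.ofReal ‖c x.1.2‖ * ENNReal.ofReal ((1 + (x.2.2 : ℝ)) * ‖c x.2.2‖ ^ 2) else 0) +
      ENNReal.ofReal E₂ * (if x.1.1 + x.1.2 = x.2.1 + x.2.2 ∧
        x.1.1 ∈ Finset.Icc x.2.1 (2 * x.2.1) then ENNReal.ofReal ‖c x.1.2‖ *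
          (ENNReal.ofReal (V x.2.1) * ((x.2.1 : ℝ≥0∞) + 1)⁻¹) else 0) := by
    rintro ⟨⟨i, l⟩, q, k⟩
    simp only
    split_ifs with h1 h2 h3 h4 h5 h5 h5 h5 <;> try exact zero_le
    -- Resonance and `q ≤ i` force `l ≤ k`, completing the order `l ≤ k ≤ q ≤ i`.
    · have hlk : l ≤ k := by omega
      have hnat : ((q : ℝ≥0∞) + 1)⁻¹ = ENNReal.ofReal (((q : ℝ) + 1)⁻¹) := by
        rw [ENNReal.ofReal_inv_of_pos (by positivity), ENNReal.ofReal_add (by positivity) one_pos.le,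
          ENNReal.ofReal_natCast, ENNReal.ofReal_one]
      rw [hnat, ← ENNReal.ofReal_mul (by positivity), ← ENNReal.ofReal_mul (by positivity),
        ← ENNReal.ofReal_mul (by positivity), ← ENNReal.ofReal_mul (by positivity),
        ← ENNReal.ofReal_mul (by positivity), ← ENNReal.ofReal_mul (by positivity),
        ← ENNReal.ofReal_add (by positivity) (by positivity)]
      rw [hE₁, hE₂]
      exact ENNReal.ofReal_le_ofReal
        (abs_resonantDiff_mul_norm_quartic_le c n hμ h4 hlk h2 h1)
    -- The window always holds: `i ≤ q + k ≤ 2q`.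
    · exact absurd ⟨h4, Finset.mem_Icc.mpr ⟨h1, by omega⟩⟩ h5
    · exact absurd h5.1 h4
    · simp [quartic, h4]
  have hn : Summable fun x => |resonantDiff w x| * ‖quartic c x‖ := by
    refine hs.norm.congr fun x => ?_
    rw [norm_mul, Complex.norm_real, Real.norm_eq_abs]
  have hE : ENNReal.ofReal (∑' x, |resonantDiff w x| * ‖quartic c x‖) ≤
      ENNReal.ofReal (8 * (E₁ * ((∑' j, V j) * S * ∑' k : ℕ, (1 + (k : ℝ)) * ‖c k‖ ^ 2) +
        E₂ * (S * ∑' j, V j))) := by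
    have hQ0 : 0 ≤ ∑' k : ℕ, (1 + (k : ℝ)) * ‖c k‖ ^ 2 := tsum_nonneg fun _ => by positivity
    rw [ENNReal.ofReal_tsum_of_nonneg (fun _ => by positivity) hn]
    refine (tsum_resonantDiff_le_ordered c w).trans ?_
    rw [ENNReal.ofReal_mul (by norm_num), ENNReal.ofReal_add (by positivity) (by positivity),
      ENNReal.ofReal_mul hE₁0, ENNReal.ofReal_mul hE₂0, ENNReal.ofReal_mul (by positivity),
      ENNReal.ofReal_mul (by positivity), ENNReal.ofReal_mul hS0,
      ENNReal.ofReal_tsum_of_nonneg (fun _ => by positivity) hVs,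
      ENNReal.ofReal_tsum_of_nonneg (fun _ => norm_nonneg _) hc,
      ENNReal.ofReal_tsum_of_nonneg (fun _ => by positivity) hQ]
    norm_num only [ENNReal.ofReal_ofNat]
    refine mul_le_mul_right ?_ 8
    refine (ENNReal.tsum_le_tsum hpt).trans ?_
    rw [ENNReal.tsum_add, ENNReal.tsum_mul_left, ENNReal.tsum_mul_left]
    exact add_le_add (mul_le_mul_right (ENNReal.tsum_resonant_le _ _ _) _)
      (mul_le_mul_right (ENNReal.tsum_resonant_window_le _ _) _)
  rw [ENNReal.ofReal_le_ofReal_iff (by positivity)] at hE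
  calc _ ≤ ‖∑' x, (resonantDiff w x : ℂ) * quartic c x‖ := Complex.abs_im_le_norm _
    _ ≤ ∑' x, ‖(resonantDiff w x : ℂ) * quartic c x‖ := norm_tsum_le_tsum_norm hs.norm
    _ = ∑' x, |resonantDiff w x| * ‖quartic c x‖ := tsum_congr fun x => by
        rw [norm_mul, Complex.norm_real, Real.norm_eq_abs]
    _ ≤ _ := hE
    _ ≤ 8 * (E₁ * ((∑' j, V j) * S * μ ^ 2) + E₂ * (S * ∑' j, V j)) := by gcongr
    _ = 8 * diffConst n * μ * S * ∑' j, V j := by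
        rw [hE₁, hE₂]; field_simp; ring
    _ ≤ 8 * diffConst n * μ * S * (2 ^ (n + 1) * ∑' k, w k * ‖c k‖ ^ 2) := by gcongr
    _ = _ := by rw [energyConst]; ring

end

/-! ### Logarithmic control of the `ℓ¹` norm and growth of Sobolev norms. -/

noncomputable section

open MeasureTheory Filter Topology Set
open scoped ComplexConjugate ENNReal

theorem abs_sobolevWeight_le (n k : ℕ) :
    |sobolevWeight n k| ≤ 1 * (1 + (k : ℝ)) ^ (2 * (n + 1)) := by
  rw [abs_of_nonneg (sobolevWeight_nonneg n k), one_mul, sobolevWeight, pow_mul]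
  refine pow_le_pow_left₀ (by positivity) ?_ _
  nlinarith [(Nat.cast_nonneg k : (0 : ℝ) ≤ k)]

theorem tsum_inv_sq_tail_le {N : ℕ} (hN : 0 < N) :
    ∑' k : ℕ, ((1 + ((k + N : ℕ) : ℝ)) ^ 2)⁻¹ ≤ (N : ℝ)⁻¹ := by
  have hN' : (0 : ℝ) < N := by exact_mod_cast hN
  refine Real.tsum_le_of_sum_range_le (fun _ => by positivity) fun m => ?_
  have : ∑ k ∈ Finset.range m, ((1 + ((k + N : ℕ) : ℝ)) ^ 2)⁻¹ ≤
      (N : ℝ)⁻¹ - ((m : ℝ) + N)⁻¹ := by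
    induction m with
    | zero => simp
    | succ m ih =>
      rw [Finset.sum_range_succ]
      have hp : (0 : ℝ) < (m : ℝ) + N := by positivity
      have : ((1 + ((m + N : ℕ) : ℝ)) ^ 2)⁻¹ ≤ ((m : ℝ) + N)⁻¹ - (((m + 1 : ℕ) : ℝ) + N)⁻¹ := by
        push_cast
        rw [inv_sub_inv (by positivity) (by positivity), inv_eq_one_div,
          div_le_div_iff₀ (by positivity) (by positivity)]
        nlinarith
      linarith
  have h2 : (0 : ℝ) ≤ ((m : ℝ) + N)⁻¹ := by positivity
  linarith

/-- A Brezis–Gallouet inequality for the `ℓ¹` norm of the Fourier coefficients. -/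
theorem tsum_norm_le_sqrt_log {c : ℕ → ℂ} {n : ℕ} {m : ℝ} (hm : 1 ≤ m)
    (hc : Summable fun k => ‖c k‖)
    (hQ : Summable fun k : ℕ => (1 + (k : ℝ)) * ‖c k‖ ^ 2)
    (hQm : ∑' k : ℕ, (1 + (k : ℝ)) * ‖c k‖ ^ 2 ≤ m ^ 2)
    (hF : Summable fun k => sobolevWeight n k * ‖c k‖ ^ 2) :
    ∑' k, ‖c k‖ ≤
      3 * m * √(Real.log (3 + ∑' k, sobolevWeight n k * ‖c k‖ ^ 2)) := by
  set F := ∑' k, sobolevWeight n k * ‖c k‖ ^ 2 with hFdef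
  have hF0 : 0 ≤ F := tsum_nonneg fun k => mul_nonneg (sobolevWeight_nonneg n k) (by positivity)
  -- The frequency cut-off is comparable to `F`: below it Cauchy–Schwarz costs a harmonic sum of
  -- size `log N`, above it `F / N ≤ 1`. The shift keeps `N` positive.
  set N := ⌈F⌉₊ + 1 with hN
  have hNpos : 0 < N := Nat.succ_pos _
  have hN' : (0 : ℝ) < N := by exact_mod_cast hNpos
  have hFN : F ≤ N := (Nat.le_ceil F).trans (by rw [hN]; push_cast; linarith)
  have hNF : (N : ℝ) ≤ 3 + F := by
    have := Nat.ceil_lt_add_one hF0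
    rw [hN]; push_cast; linarith
  set L := Real.log (3 + F) with hL
  -- The `3` inside the logarithm is there because `e < 3`, which makes `L ≥ 1` and lets constants
  -- be absorbed in `√L`.
  have hL1 : 1 ≤ L := by
    rw [hL, Real.le_log_iff_exp_le (by positivity)]
    linarith [Real.exp_one_lt_three]
  have hsL : 1 ≤ √L := by rwa [Real.one_le_sqrt]
  have head : ∑ k ∈ Finset.range N, ‖c k‖ ≤ m * (3 / 2 * √L) := by
    have cs := Finset.sum_mul_sq_le_sq_mul_sq (Finset.range N)
      (fun k : ℕ => √((1 + (k : ℝ))⁻¹)) (fun k => √(1 + (k : ℝ)) * ‖c k‖)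
    have e1 : ∀ k : ℕ, √((1 + (k : ℝ))⁻¹) * (√(1 + (k : ℝ)) * ‖c k‖) = ‖c k‖ := fun k => by
      rw [← mul_assoc, ← Real.sqrt_mul (by positivity), inv_mul_cancel₀ (by positivity),
        Real.sqrt_one, one_mul]
    have e2 : ∀ k : ℕ, √((1 + (k : ℝ))⁻¹) ^ 2 = (1 + (k : ℝ))⁻¹ := fun k =>
      Real.sq_sqrt (by positivity)
    have e3 : ∀ k : ℕ, (√(1 + (k : ℝ)) * ‖c k‖) ^ 2 = (1 + (k : ℝ)) * ‖c k‖ ^ 2 := fun k => by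
      rw [mul_pow, Real.sq_sqrt (by positivity)]
    simp only [e1, e2, e3] at cs
    have hq : ∑ k ∈ Finset.range N, (1 + (k : ℝ)) * ‖c k‖ ^ 2 ≤ m ^ 2 :=
      (hQ.sum_le_tsum _ (fun _ _ => by positivity)).trans hQm
    have hh : ∑ k ∈ Finset.range N, (1 + (k : ℝ))⁻¹ ≤ 2 * L := by
      have h1 := harmonic_le_one_add_log N
      rw [harmonic] at h1
      push_cast at h1
      have h2 : Real.log N ≤ L := Real.log_le_log hN' hNF
      simp_rw [add_comm (1 : ℝ)]
      linarith
    refine le_of_sq_le_sq ?_ (by positivity)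
    calc _ ≤ _ := cs
      _ ≤ 2 * L * m ^ 2 := mul_le_mul hh hq (Finset.sum_nonneg fun _ _ => by positivity)
          (by linarith)
      _ ≤ (m * (3 / 2 * √L)) ^ 2 := by
          rw [mul_pow, mul_pow, Real.sq_sqrt (by linarith)]
          nlinarith [mul_nonneg (sq_nonneg m) (by linarith : 0 ≤ L)]
  have tail : ∑' k, ‖c (k + N)‖ ≤ 3 / 2 := by
    have hinj : Function.Injective fun k : ℕ => k + N := add_left_injective N
    have hw : ∀ k : ℕ, (1 + (k : ℝ)) ^ 2 * ‖c k‖ ^ 2 ≤ 2 * (sobolevWeight n k * ‖c k‖ ^ 2) := by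
      intro k
      have h1 : 1 + (k : ℝ) ^ 2 ≤ sobolevWeight n k :=
        le_self_pow₀ (by nlinarith [sq_nonneg (k : ℝ)]) (by omega)
      have h2 : (1 + (k : ℝ)) ^ 2 ≤ 2 * sobolevWeight n k := by
        nlinarith [sq_nonneg ((k : ℝ) - 1)]
      rw [← mul_assoc]
      exact mul_le_mul_of_nonneg_right h2 (by positivity)
    have hFN' := hF.comp_injective hinj
    have hS := (summable_one_add_inv_sq.comp_injective hinj)
    have hpt : ∀ k, ‖c (k + N)‖ ≤
        (N : ℝ)⁻¹ * (sobolevWeight n (k + N) * ‖c (k + N)‖ ^ 2) +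
          N / 2 * ((1 + ((k + N : ℕ) : ℝ)) ^ 2)⁻¹ := fun k => by
      have h1 := hw (k + N)
      set a := ‖c (k + N)‖
      have hz : (0 : ℝ) < 1 + ((k + N : ℕ) : ℝ) := by positivity
      set z := 1 + ((k + N : ℕ) : ℝ)
      -- AM-GM with parameter `N`: after summation the two parts contribute at most `1` and `1 / 2`.
      have h2 : a ≤ (N : ℝ)⁻¹ * (z ^ 2 * a ^ 2 / 2) + N / 2 * (z ^ 2)⁻¹ := by
        have := mul_nonneg (inv_pos.mpr hN').le (sq_nonneg (z * a - N * z⁻¹))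
        have e : (N : ℝ)⁻¹ * (z * a - N * z⁻¹) ^ 2 =
            2 * ((N : ℝ)⁻¹ * (z ^ 2 * a ^ 2 / 2) + N / 2 * (z ^ 2)⁻¹ - a) := by
          field_simp; ring
        linarith
      refine h2.trans ?_
      gcongr
      linarith
    have s1 : Summable fun k => (N : ℝ)⁻¹ * (sobolevWeight n (k + N) * ‖c (k + N)‖ ^ 2) :=
      hFN'.mul_left _
    have s2 : Summable fun k : ℕ => (N : ℝ) / 2 * ((1 + ((k + N : ℕ) : ℝ)) ^ 2)⁻¹ :=
      hS.mul_left _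
    calc _ ≤ _ := (hc.comp_injective hinj).tsum_le_tsum hpt (s1.add s2)
      _ = (N : ℝ)⁻¹ * (∑' k, sobolevWeight n (k + N) * ‖c (k + N)‖ ^ 2) +
          N / 2 * ∑' k : ℕ, ((1 + ((k + N : ℕ) : ℝ)) ^ 2)⁻¹ := by
          rw [s1.tsum_add s2, tsum_mul_left, tsum_mul_left]
      _ ≤ (N : ℝ)⁻¹ * N + N / 2 * (N : ℝ)⁻¹ := by
          gcongr
          · refine le_trans ?_ hFN
            exact tsum_comp_le_tsum_of_inj hF
              (fun k => mul_nonneg (sobolevWeight_nonneg n k) (by positivity)) hinj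
          · exact tsum_inv_sq_tail_le hNpos
      _ = 3 / 2 := by field_simp; norm_num
  rw [← hc.sum_add_tsum_nat_add N]
  nlinarith

namespace SzegoFlow

variable {c : ℝ → ℕ → ℂ}

theorem summable_half (h : SzegoFlow c) (t : ℝ) :
    Summable fun k : ℕ => (1 + (k : ℝ)) * ‖c t k‖ ^ 2 :=
  h.summable_energy (w := fun k : ℕ => 1 + (k : ℝ)) (N := 1) (K := 1)
    (fun k => by rw [one_mul, pow_one, abs_of_nonneg (by positivity)]) t

theorem summable_sobolev (h : SzegoFlow c) (n : ℕ) (t : ℝ) :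
    Summable fun k => sobolevWeight n k * ‖c t k‖ ^ 2 :=
  h.summable_energy (abs_sobolevWeight_le n) t

theorem exists_hasDerivAt_sobolev (h : SzegoFlow c) (n : ℕ) {μ : ℝ} (hμ : 0 < μ)
    (hQ : ∑' k : ℕ, (1 + (k : ℝ)) * ‖c 0 k‖ ^ 2 ≤ μ ^ 2) (t : ℝ) :
    ∃ D, HasDerivAt (fun τ => ∑' k, sobolevWeight n k * ‖c τ k‖ ^ 2) D t ∧
      |D| ≤ energyConst n / 2 * μ * (∑' k, ‖c t k‖) * ∑' k, sobolevWeight n k * ‖c t k‖ ^ 2 := by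
  refine ⟨_, h.hasDerivAt_energy (abs_sobolevWeight_le n) t, ?_⟩
  have := tsum_resonantDiff_quartic_le (n := n) hμ (h.summable_norm t) (h.summable_half t)
    ((h.halfNorm_const t).trans_le hQ) (h.summable_sobolev n t)
    (two_mul_im_tsum_quartic (h.summable_norm t)
      (h.summable_abs_weight (abs_sobolevWeight_le n) t)).2
  rw [abs_mul, abs_of_pos (by norm_num)]
  linarith

/-- Grönwall: `log (1 + F)` is Lipschitz in time. The added `1` covers `F = 0`. -/
theorem sobolev_le_of_tsum_norm_le (h : SzegoFlow c) (n : ℕ) {μ S : ℝ} (hμ : 0 < μ)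
    (hQ : ∑' k : ℕ, (1 + (k : ℝ)) * ‖c 0 k‖ ^ 2 ≤ μ ^ 2) (hS : ∀ t, ∑' k, ‖c t k‖ ≤ S) (t : ℝ) :
    ∑' k, sobolevWeight n k * ‖c t k‖ ^ 2 ≤
      (1 + ∑' k, sobolevWeight n k * ‖c 0 k‖ ^ 2) *
        Real.exp (energyConst n / 2 * μ * S * |t|) := by
  choose D hD hDle using h.exists_hasDerivAt_sobolev n hμ hQ
  have hE := energyConst_pos n
  set F : ℝ → ℝ := fun τ => ∑' k, sobolevWeight n k * ‖c τ k‖ ^ 2 with hF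
  have hF0 : ∀ τ, 0 ≤ F τ := fun τ =>
    tsum_nonneg fun k => mul_nonneg (sobolevWeight_nonneg n k) (by positivity)
  have hS0 : 0 ≤ S := (tsum_nonneg fun _ => norm_nonneg _).trans (hS 0)
  have key := Convex.norm_image_sub_le_of_norm_hasDerivWithin_le (s := univ) (x := 0) (y := t)
    (f := fun τ => Real.log (1 + F τ)) (f' := fun τ => D τ / (1 + F τ))
    (C := energyConst n / 2 * μ * S)
    (fun τ _ => (((hD τ).const_add 1).log (by linarith [hF0 τ])).hasDerivWithinAt)
    (fun τ _ => ?_) convex_univ (mem_univ _) (mem_univ _)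
  · rw [Real.norm_eq_abs, Real.norm_eq_abs, sub_zero] at key
    have h1 := (le_abs_self _).trans key
    have h2 : Real.log (1 + F t) ≤ Real.log (1 + F 0) + energyConst n / 2 * μ * S * |t| := by
      linarith
    have h3 := Real.exp_le_exp.mpr h2
    rw [Real.exp_add, Real.exp_log (by linarith [hF0 t]), Real.exp_log (by linarith [hF0 0])] at h3
    linarith
  · have hp : 0 < 1 + F τ := by linarith [hF0 τ]
    rw [norm_div, Real.norm_eq_abs, Real.norm_of_nonneg hp.le, div_le_iff₀ hp]
    refine (hDle τ).trans ?_
    have := hF0 τ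
    calc _ ≤ energyConst n / 2 * μ * S * F τ := by gcongr; exact hS τ
      _ ≤ _ := by gcongr; linarith

/-- Inserting the logarithmic inequality, `F'` is at most a multiple of `m² √log(3 + F) F`. The root
cancels when `√log(3 + F)` is differentiated, so this function is Lipschitz; squaring turns linear
growth into `t²`. -/
theorem sobolev_le_gaussian (h : SzegoFlow c) (n : ℕ) {m : ℝ} (hm : 1 ≤ m)
    (hQ : ∑' k : ℕ, (1 + (k : ℝ)) * ‖c 0 k‖ ^ 2 ≤ m ^ 2) (t : ℝ) :
    ∑' k, sobolevWeight n k * ‖c t k‖ ^ 2 ≤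
      (3 + ∑' k, sobolevWeight n k * ‖c 0 k‖ ^ 2) ^ 2 *
        Real.exp (2 * (energyConst n * m ^ 2 * |t|) ^ 2) := by
  choose D hD hDle using h.exists_hasDerivAt_sobolev n (by linarith) hQ
  have hE := energyConst_pos n
  set F : ℝ → ℝ := fun τ => ∑' k, sobolevWeight n k * ‖c τ k‖ ^ 2 with hF
  have hF0 : ∀ τ, 0 ≤ F τ := fun τ =>
    tsum_nonneg fun k => mul_nonneg (sobolevWeight_nonneg n k) (by positivity)
  have hL1 : ∀ τ, 1 ≤ Real.log (3 + F τ) := fun τ => by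
    rw [Real.le_log_iff_exp_le (by linarith [hF0 τ])]
    linarith [Real.exp_one_lt_three, hF0 τ]
  have hA : ∀ τ, ∑' k, ‖c τ k‖ ≤ 3 * m * √(Real.log (3 + F τ)) := fun τ =>
    tsum_norm_le_sqrt_log hm (h.summable_norm τ) (h.summable_half τ)
      ((h.halfNorm_const τ).trans_le hQ) (h.summable_sobolev n τ)
  have key := Convex.norm_image_sub_le_of_norm_hasDerivWithin_le (s := univ) (x := 0) (y := t)
    (f := fun τ => √(Real.log (3 + F τ)))
    (f' := fun τ => D τ / (3 + F τ) / (2 * √(Real.log (3 + F τ))))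
    (C := energyConst n * m ^ 2)
    (fun τ _ => ((((hD τ).const_add 3).log (by linarith [hF0 τ])).sqrt
      (by linarith [hL1 τ])).hasDerivWithinAt)
    (fun τ _ => ?_) convex_univ (mem_univ _) (mem_univ _)
  · rw [Real.norm_eq_abs, Real.norm_eq_abs, sub_zero] at key
    have h1 := (le_abs_self _).trans key
    set y := √(Real.log (3 + F t)) with hy
    set y₀ := √(Real.log (3 + F 0)) with hy₀
    have sy : y ^ 2 = Real.log (3 + F t) := Real.sq_sqrt (by linarith [hL1 t])
    have sy₀ : y₀ ^ 2 = Real.log (3 + F 0) := Real.sq_sqrt (by linarith [hL1 0])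
    have hy0 : 0 ≤ y := Real.sqrt_nonneg _
    set κ := energyConst n * m ^ 2 * |t| with hκ
    -- `(y₀ + κ)² ≤ 2 y₀² + 2 κ²`; the doubled logarithm is the source of the square `(3 + F 0)²`.
    have h2 : Real.log (3 + F t) ≤ Real.log (3 + F 0) + Real.log (3 + F 0) + 2 * κ ^ 2 := by
      rw [← sy, ← sy₀]
      have : y ^ 2 ≤ (y₀ + κ) ^ 2 := pow_le_pow_left₀ hy0 (by linarith) 2
      nlinarith [sq_nonneg (y₀ - κ)]
    have h3 := Real.exp_le_exp.mpr h2
    rw [Real.exp_add, Real.exp_add, Real.exp_log (by linarith [hF0 t]),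
      Real.exp_log (by linarith [hF0 0])] at h3
    rw [pow_two]
    linarith
  · have hp : 0 < 3 + F τ := by linarith [hF0 τ]
    have hs : 0 < √(Real.log (3 + F τ)) := Real.sqrt_pos.mpr (by linarith [hL1 τ])
    rw [norm_div, norm_div, Real.norm_eq_abs, Real.norm_of_nonneg hp.le,
      Real.norm_of_nonneg (by positivity), div_div, div_le_iff₀ (by positivity)]
    refine (hDle τ).trans ?_
    have := hF0 τ
    calc _ ≤ energyConst n / 2 * m * (3 * m * √(Real.log (3 + F τ))) * F τ := by
          gcongr; exact hA τ
      _ = energyConst n * m ^ 2 * √(Real.log (3 + F τ)) * (3 / 2 * F τ) := by ring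
      _ ≤ energyConst n * m ^ 2 * √(Real.log (3 + F τ)) * (2 * (3 + F τ)) := by
          refine mul_le_mul_of_nonneg_left (by linarith) (by positivity)
      _ = _ := by ring

end SzegoFlow
end

/-! ### The trace norm as a dual norm, and its behaviour under Lax equations. -/

noncomputable section

open MeasureTheory Filter Topology Set
open scoped ComplexConjugate ENNReal Matrix Matrix.Norms.L2Operator

/-- The dual of a normed space, for the topology given by the norm. -/
abbrev NormDual (V : Type*) [NormedAddCommGroup V] [NormedSpace ℂ V] : Type _ := V →L[ℂ] ℂ

section TraceForm

variable {n : Type*} [Fintype n] [DecidableEq n]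

theorem norm_entry_le (D : Matrix n n ℂ) (j k : n) : ‖D j k‖ ≤ ‖D‖ := by
  have h1 := Matrix.l2_opNorm_mulVec D (EuclideanSpace.single k (1 : ℂ))
  have h2 := PiLp.norm_apply_le (p := 2)
    ((EuclideanSpace.equiv n ℂ).symm (D.mulVec (EuclideanSpace.single k (1 : ℂ)))) j
  simp at h1 h2
  exact h2.trans h1

/-- The functional `D ↦ D k j`. -/
def entryForm (j k : n) : NormDual (Matrix n n ℂ) :=
  LinearMap.mkContinuous (Matrix.entryLinearMap ℂ ℂ k j) 1
    (fun D => by simpa using norm_entry_le D k j)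

/-- The functional `D ↦ tr (M D)`, whose operator norm is the trace norm of `M`. -/
def traceForm (M : Matrix n n ℂ) : NormDual (Matrix n n ℂ) :=
  ∑ j, ∑ k, M j k • entryForm j k

theorem traceForm_apply (M D : Matrix n n ℂ) : traceForm M D = (M * D).trace := by
  simp [traceForm, entryForm, Matrix.trace, Matrix.mul_apply]

theorem hasDerivAt_traceForm {M : ℝ → Matrix n n ℂ} {M' : Matrix n n ℂ} {t : ℝ}
    (h : ∀ j k, HasDerivAt (fun τ => M τ j k) (M' j k) t) :
    HasDerivAt (fun τ => traceForm (M τ)) (traceForm M') t :=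
  HasDerivAt.fun_sum fun j _ => HasDerivAt.fun_sum fun k _ => (h j k).smul_const (entryForm j k)

theorem norm_traceForm_apply_le (M D : Matrix n n ℂ) :
    ‖traceForm M D‖ ≤ (∑ j, ∑ k, ‖M j k‖) * ‖D‖ := by
  rw [traceForm_apply, Matrix.trace, Finset.sum_mul]
  refine (norm_sum_le _ _).trans (Finset.sum_le_sum fun j _ => ?_)
  rw [Matrix.diag_apply, Matrix.mul_apply, Finset.sum_mul]
  refine (norm_sum_le _ _).trans (Finset.sum_le_sum fun k _ => ?_)
  rw [norm_mul]
  exact mul_le_mul_of_nonneg_left (norm_entry_le D k j) (norm_nonneg _)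

theorem norm_traceForm_le (M : Matrix n n ℂ) : ‖traceForm M‖ ≤ ∑ j, ∑ k, ‖M j k‖ :=
  ContinuousLinearMap.opNorm_le_bound _
    (Finset.sum_nonneg fun _ _ => Finset.sum_nonneg fun _ _ => norm_nonneg _)
    (norm_traceForm_apply_le M)

theorem traceForm_add (M M' : Matrix n n ℂ) : traceForm (M + M') = traceForm M + traceForm M' := by
  ext D; simp [traceForm_apply, add_mul]

variable [Nonempty n]

/-- Test the functional on the permutation matrix of `σ` with phases aligning the entries; it is
unitary, so it has norm `1`. -/
theorem sum_norm_perm_le (M : Matrix n n ℂ) (σ : Equiv.Perm n) :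
    ∑ j, ‖M j (σ j)‖ ≤ ‖traceForm M‖ := by
  choose d hd1 hd2 using fun j : n => Complex.exists_norm_eq_mul_self (M j (σ j))
  set D : Matrix n n ℂ := Matrix.of fun k j => if k = σ j then d j else 0 with hD
  have hDD : Dᴴ * D = 1 := by
    ext j j'
    rw [Matrix.mul_apply, Finset.sum_eq_single (σ j)]
    · simp only [Matrix.conjTranspose_apply, hD, Matrix.of_apply, if_true,
        EmbeddingLike.apply_eq_iff_eq, Matrix.one_apply]
      split_ifs with h
      · subst h
        rw [mul_comm]
        exact (Complex.mul_conj' (d j)).trans (by rw [hd1]; simp)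
      · rw [mul_zero]
    · intro k _ hk
      simp [hD, hk]
    · simp
  have hDn : ‖D‖ = 1 := by
    have h1 := Matrix.l2_opNorm_conjTranspose_mul_self D
    rw [hDD, CStarRing.norm_one] at h1
    nlinarith [norm_nonneg D]
  have htr : traceForm M D = ((∑ j, ‖M j (σ j)‖ : ℝ) : ℂ) := by
    rw [traceForm_apply, Matrix.trace, Complex.ofReal_sum]
    refine Finset.sum_congr rfl fun j _ => ?_
    rw [Matrix.diag_apply, Matrix.mul_apply, Finset.sum_eq_single (σ j), hd2, mul_comm]
    · simp [hD]
    · intro k _ hk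
      simp [hD, hk]
    · simp
  have h1 := (traceForm M).le_opNorm D
  rw [htr, hDn, mul_one, Complex.norm_real, Real.norm_eq_abs] at h1
  exact (le_abs_self _).trans h1

/-- The first-order terms of `(1 + hA)ᴴ (1 + hA)` cancel, leaving `1 - h² A²`. -/
theorem norm_one_add_smul_le {A : Matrix n n ℂ} (hA : Aᴴ = -A) (h : ℝ) :
    ‖1 + (h : ℂ) • A‖ ^ 2 ≤ 1 + h ^ 2 * ‖A‖ ^ 2 := by
  have e : (1 + (h : ℂ) • A)ᴴ * (1 + (h : ℂ) • A) = 1 - ((h : ℂ) ^ 2) • (A * A) := by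
    rw [Matrix.conjTranspose_add, Matrix.conjTranspose_one, Matrix.conjTranspose_smul, hA]
    rw [Complex.star_def, Complex.conj_ofReal]
    simp only [add_mul, mul_add, one_mul, mul_one, Matrix.smul_mul, Matrix.mul_smul, smul_smul,
      smul_neg, neg_mul, pow_two]
    abel
  rw [pow_two, ← Matrix.l2_opNorm_conjTranspose_mul_self, e]
  refine (norm_sub_le _ _).trans ?_
  rw [CStarRing.norm_one, norm_smul, norm_pow, Complex.norm_real, Real.norm_eq_abs, sq_abs]
  gcongr
  rw [pow_two]
  exact norm_mul_le _ _

/-- Conjugating by the linearised flow of an anti-Hermitian matrix increases the trace norm only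
to second order. -/
theorem norm_traceForm_step_le {A : Matrix n n ℂ} (hA : Aᴴ = -A) (M : Matrix n n ℂ) (h : ℝ) :
    ‖traceForm M + h • traceForm (A * M + M * Aᵀ)‖ ≤
      ‖traceForm M‖ * (1 + h ^ 2 * (‖A‖ + ‖Aᵀ‖) ^ 2 + h ^ 2 * (‖A‖ + ‖Aᵀ‖) ^ 2) := by
  set a := ‖A‖ + ‖Aᵀ‖ with ha
  have hAT : Aᵀᴴ = -Aᵀ := by
    rw [← Matrix.transpose_neg, ← hA]
    rfl
  have b1 : ‖1 + (h : ℂ) • A‖ ^ 2 ≤ 1 + h ^ 2 * a ^ 2 := by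
    refine (norm_one_add_smul_le hA h).trans ?_
    gcongr
    exact le_add_of_nonneg_right (norm_nonneg _)
  have b2 : ‖1 + (h : ℂ) • Aᵀ‖ ^ 2 ≤ 1 + h ^ 2 * a ^ 2 := by
    refine (norm_one_add_smul_le hAT h).trans ?_
    gcongr
    exact le_add_of_nonneg_left (norm_nonneg _)
  refine ContinuousLinearMap.opNorm_le_bound _ (by positivity) fun D => ?_
  -- Expand `(1 + hA) M (1 + hAᵀ)` and move both factors onto `D` by cyclicity of the trace; the
  -- leftover is quadratic in `h`.
  have e : (traceForm M + h • traceForm (A * M + M * Aᵀ)) D =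
      traceForm M ((1 + (h : ℂ) • Aᵀ) * D * (1 + (h : ℂ) • A)) -
        (h : ℂ) ^ 2 * traceForm M (Aᵀ * D * A) := by
    have e1 : (A * M * D).trace = (M * D * A).trace := by
      rw [mul_assoc, Matrix.trace_mul_comm]
    simp only [_root_.add_apply, _root_.smul_apply, traceForm_apply,
      add_mul, mul_add, one_mul, mul_one, Matrix.trace_add, Matrix.smul_mul, Matrix.mul_smul,
      Matrix.trace_smul, smul_eq_mul, Complex.real_smul, e1, ← mul_assoc, smul_add]
    ring
  have c1 : ‖(1 + (h : ℂ) • Aᵀ) * D * (1 + (h : ℂ) • A)‖ ≤ (1 + h ^ 2 * a ^ 2) * ‖D‖ := by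
    have : ‖1 + (h : ℂ) • Aᵀ‖ * ‖1 + (h : ℂ) • A‖ ≤ 1 + h ^ 2 * a ^ 2 := by
      nlinarith [sq_nonneg (‖1 + (h : ℂ) • Aᵀ‖ - ‖1 + (h : ℂ) • A‖)]
    calc _ ≤ ‖1 + (h : ℂ) • Aᵀ‖ * ‖D‖ * ‖1 + (h : ℂ) • A‖ :=
          (norm_mul_le _ _).trans (by gcongr; exact norm_mul_le _ _)
      _ = ‖1 + (h : ℂ) • Aᵀ‖ * ‖1 + (h : ℂ) • A‖ * ‖D‖ := by ring
      _ ≤ _ := by gcongr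
  have c2 : ‖Aᵀ * D * A‖ ≤ a ^ 2 * ‖D‖ := by
    have : ‖Aᵀ‖ * ‖A‖ ≤ a ^ 2 := by
      rw [ha]; nlinarith [norm_nonneg A, norm_nonneg Aᵀ]
    calc _ ≤ ‖Aᵀ‖ * ‖D‖ * ‖A‖ := (norm_mul_le _ _).trans (by gcongr; exact norm_mul_le _ _)
      _ = ‖Aᵀ‖ * ‖A‖ * ‖D‖ := by ring
      _ ≤ _ := by gcongr
  rw [e]
  refine (norm_sub_le _ _).trans ?_
  rw [norm_mul, norm_pow, Complex.norm_real, Real.norm_eq_abs, sq_abs]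
  calc _ ≤ ‖traceForm M‖ * ((1 + h ^ 2 * a ^ 2) * ‖D‖) +
        h ^ 2 * (‖traceForm M‖ * (a ^ 2 * ‖D‖)) := by
        gcongr
        · exact (ContinuousLinearMap.le_opNorm _ _).trans (by gcongr)
        · exact (ContinuousLinearMap.le_opNorm _ _).trans (by gcongr)
    _ = _ := by ring

/-- Almost conservation of the trace norm along an approximate Lax equation. -/
theorem norm_traceForm_le_of_lax {M A E : ℝ → Matrix n n ℂ} {T ε K : ℝ}
    (hA : ∀ t, (A t)ᴴ = -A t)
    (hM : ∀ t j k, HasDerivAt (fun τ => M τ j k) ((A t * M t + M t * (A t)ᵀ + E t) j k) t)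
    (hE : ∀ t ∈ Icc 0 T, ‖traceForm (E t)‖ < ε) (hK : ‖traceForm (M 0)‖ ≤ K) :
    ∀ t ∈ Icc 0 T, ‖traceForm (M t)‖ ≤ K + ε * t := by
  have hd := fun t => hasDerivAt_traceForm (hM t)
  -- The trace norm need not be differentiable along the flow, so the comparison uses right slopes.
  refine image_norm_le_of_liminf_right_slope_norm_lt_deriv_boundary
    (f := fun t => traceForm (M t)) (f' := fun t => ‖traceForm (E t)‖) (B' := fun _ => ε)
    (fun t _ => (hd t).continuousAt.continuousWithinAt) ?_ (by simpa using hK)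
    (by fun_prop) (fun t _ => ?_) (fun t ht _ => hE t ⟨ht.1, ht.2.le⟩)
  · intro t ht r hr
    refine Eventually.frequently ?_
    -- One third of the slack absorbs the differentiation remainder, another the second-order term
    -- of the step.
    set δ := (r - ‖traceForm (E t)‖) / 3 with hδ
    have hδ0 : 0 < δ := by rw [hδ]; linarith
    set a := ‖A t‖ + ‖(A t)ᵀ‖
    have h1 := (hasDerivAt_iff_isLittleO.mp (hd t)).def hδ0
    have h2 : ∀ᶠ z in 𝓝 t, (z - t) * (‖traceForm (M t)‖ * (2 * a ^ 2)) < δ := by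
      have : Tendsto (fun z => (z - t) * (‖traceForm (M t)‖ * (2 * a ^ 2))) (𝓝 t) (𝓝 0) := by
        have : Continuous fun z : ℝ => (z - t) * (‖traceForm (M t)‖ * (2 * a ^ 2)) := by fun_prop
        simpa using this.tendsto t
      exact this.eventually (gt_mem_nhds hδ0)
    filter_upwards [nhdsWithin_le_nhds h1, nhdsWithin_le_nhds h2, self_mem_nhdsWithin]
      with z hz1 hz2 hz
    have hz0 : 0 < z - t := sub_pos.mpr hz
    rw [slope_def_field, div_lt_iff₀ hz0]
    have hs := norm_traceForm_step_le (hA t) (M t) (z - t)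
    rw [Real.norm_of_nonneg hz0.le, traceForm_add, smul_add] at hz1
    have tri : ‖traceForm (M z)‖ ≤
        δ * (z - t) + ‖traceForm (M t) + (z - t) • traceForm (A t * M t + M t * (A t)ᵀ)‖ +
          (z - t) * ‖traceForm (E t)‖ := by
      have e : traceForm (M z) = (traceForm (M z) - traceForm (M t) -
          ((z - t) • traceForm (A t * M t + M t * (A t)ᵀ) + (z - t) • traceForm (E t))) +
          (traceForm (M t) + (z - t) • traceForm (A t * M t + M t * (A t)ᵀ)) +
          (z - t) • traceForm (E t) := by abel
      have hn : ‖(z - t) • traceForm (E t)‖ = (z - t) * ‖traceForm (E t)‖ := by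
        rw [norm_smul, Real.norm_of_nonneg hz0.le]
      have h3 := norm_add₃_le (a := traceForm (M z) - traceForm (M t) -
          ((z - t) • traceForm (A t * M t + M t * (A t)ᵀ) + (z - t) • traceForm (E t)))
        (b := traceForm (M t) + (z - t) • traceForm (A t * M t + M t * (A t)ᵀ))
        (c := (z - t) • traceForm (E t))
      rw [← e, hn] at h3
      linarith
    have hr' : r = 3 * δ + ‖traceForm (E t)‖ := by rw [hδ]; ring
    have hz3 := mul_lt_mul_of_pos_left hz2 hz0
    simp only [Function.comp]
    rw [hr']
    nlinarith
  · exact ((hasDerivAt_id t).const_mul ε |>.const_add K |>.congr_deriv (mul_one _)).hasDerivWithinAt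

end TraceForm
end

/-! ### The Lax pair for Hankel matrices and the uniform `ℓ¹` bound. -/

noncomputable section

open MeasureTheory Filter Topology Set
open scoped ComplexConjugate ENNReal Matrix Matrix.Norms.L2Operator

/-- `I` times the matrix entries of the anti-Hermitian operator in the Lax pair. -/
def laxEntry (c : ℕ → ℂ) (j l : ℕ) : ℂ :=
  ∑' y : ℕ × ℕ, if y.1 + l = y.2 + j then
    (if y.1 < j then 1 else 1 / 2) * (c y.1 * conj (c y.2)) else 0

/-- The resonant cubic terms `((i, r), q)` with `k ≤ r`, counted with weight `1` if `i < j` and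
`1 / 2` otherwise. -/
def cubicHalf (c : ℕ → ℂ) (j k : ℕ) (x : (ℕ × ℕ) × ℕ) : ℂ :=
  if x.1.1 + x.1.2 = x.2 + (j + k) ∧ k ≤ x.1.2 then
    (if x.1.1 < j then 1 else 1 / 2) * (c x.1.1 * c x.1.2 * conj (c x.2)) else 0

section Lax

variable {c : ℕ → ℂ}

theorem norm_laxEntry_le (hc : Summable fun k => ‖c k‖) (j l : ℕ) :
    ‖laxEntry c j l‖ ≤ (∑' k, ‖c k‖) ^ 2 := by
  have h2 := hc.mul_of_nonneg hc (fun _ => norm_nonneg _) (fun _ => norm_nonneg _)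
  rw [pow_two, hc.tsum_mul_tsum hc h2]
  refine tsum_of_norm_bounded h2.hasSum fun y => ?_
  split_ifs
  · simp
  · rw [norm_mul, norm_mul, RCLike.norm_conj]
    exact mul_le_of_le_one_left (by positivity) (by norm_num)
  · simp only [norm_zero]; positivity

/-- When `y.1 + l = y.2 + j`, the conditions `y.1 < j` and `y.2 < l` are equivalent, so the weights
are symmetric. The matrix is the Toeplitz matrix of `|u|²` minus half of the Hankel matrix times its
adjoint. -/
theorem conj_laxEntry (j l : ℕ) : conj (laxEntry c l j) = laxEntry c j l := by
  rw [laxEntry, laxEntry, Complex.conj_tsum, ← (Equiv.prodComm ℕ ℕ).tsum_eq]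
  refine tsum_congr fun y => ?_
  change conj (if y.2 + j = y.1 + l then
    (if y.2 < l then 1 else 1 / 2) * (c y.2 * conj (c y.1)) else 0) = _
  by_cases h : y.1 + l = y.2 + j
  · rw [if_pos h, if_pos h.symm]
    have : y.2 < l ↔ y.1 < j := by omega
    simp only [this]
    split_ifs
    · simp [mul_comm]
    · simp only [map_mul, map_div₀, map_one, map_ofNat, Complex.conj_conj]
      ring
  · rw [if_neg h, if_neg (Ne.symm h), map_zero]

theorem summable_cubic_norm (hc : Summable fun k => ‖c k‖) :
    Summable fun x : (ℕ × ℕ) × ℕ => ‖c x.1.1‖ * ‖c x.1.2‖ * ‖c x.2‖ :=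
  Summable.mul_of_nonneg (f := fun y : ℕ × ℕ => ‖c y.1‖ * ‖c y.2‖) (g := fun k => ‖c k‖)
    (hc.mul_of_nonneg hc (fun _ => norm_nonneg _) (fun _ => norm_nonneg _)) hc
    (fun _ => by positivity) (fun _ => norm_nonneg _)

theorem summable_cubicHalf (hc : Summable fun k => ‖c k‖) (j k : ℕ) :
    Summable (cubicHalf c j k) := by
  refine (summable_cubic_norm hc).of_norm_bounded fun x => ?_
  unfold cubicHalf
  split_ifs
  · simp
  · rw [norm_mul, norm_mul, norm_mul, RCLike.norm_conj]
    exact mul_le_of_le_one_left (by positivity) (by norm_num)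
  · simp only [norm_zero]; positivity

/-- Substitute `r = l + k`; the condition `k ≤ r` is exactly what this allows. -/
theorem tsum_cubicHalf (hc : Summable fun k => ‖c k‖) (j k : ℕ) :
    ∑' x, cubicHalf c j k x = ∑' l, laxEntry c j l * c (l + k) := by
  let e : ℕ × (ℕ × ℕ) ≃ (ℕ × ℕ) × ℕ :=
    { toFun := fun y => ((y.2.1, y.1), y.2.2)
      invFun := fun x => (x.1.2, (x.1.1, x.2))
      left_inv := fun _ => rfl
      right_inv := fun _ => rfl }
  have hs : Summable fun y => cubicHalf c j k (e y) :=
    (summable_cubicHalf hc j k).comp_injective e.injective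
  rw [← e.tsum_eq, hs.tsum_prod, ← (add_left_injective k).tsum_eq]
  · refine tsum_congr fun l => ?_
    rw [laxEntry, ← tsum_mul_right]
    refine tsum_congr fun y => ?_
    simp only [e, Equiv.coe_fn_mk, cubicHalf]
    rw [if_congr (show y.1 + (l + k) = y.2 + (j + k) ∧ k ≤ l + k ↔ y.1 + l = y.2 + j by omega)
      rfl rfl]
    split_ifs <;> ring
  · intro r hr
    by_contra hcon
    refine hr ?_
    have hrk : ¬ k ≤ r := fun h => hcon ⟨r - k, Nat.sub_add_cancel h⟩
    simp [e, cubicHalf, hrk]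

/-- If `i + r = q + j + k`, then `k ≤ r` or `j ≤ i`. When only one holds, its half carries weight
`1`; when both hold, each carries `1 / 2`. So every resonant term is counted once. -/
theorem cubicCoeff_add_eq (hc : Summable fun k => ‖c k‖) (j k : ℕ) :
    cubicCoeff c (j + k) =
      ∑' l, laxEntry c j l * c (l + k) + ∑' l, laxEntry c k l * c (l + j) := by
  rw [← tsum_cubicHalf hc, ← tsum_cubicHalf hc]
  let e : (ℕ × ℕ) × ℕ ≃ (ℕ × ℕ) × ℕ := (Equiv.prodComm ℕ ℕ).prodCongr (Equiv.refl _)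
  have hs : Summable fun x => cubicHalf c k j (e x) :=
    (summable_cubicHalf hc k j).comp_injective e.injective
  rw [← e.tsum_eq (cubicHalf c k j), ← (summable_cubicHalf hc j k).tsum_add hs, cubicCoeff]
  refine tsum_congr fun x => ?_
  change _ = cubicHalf c j k x + cubicHalf c k j (x.1.swap, x.2)
  simp only [cubicHalf, Prod.fst_swap, Prod.snd_swap]
  by_cases h : x.1.1 + x.1.2 = x.2 + (j + k)
  · have h' : x.1.2 + x.1.1 = x.2 + (k + j) := by omega
    simp only [h, h', true_and, if_true]
    by_cases h1 : k ≤ x.1.2 <;> by_cases h2 : j ≤ x.1.1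
    · simp only [h1, h2, not_lt.mpr h1, not_lt.mpr h2, if_true, if_false]; ring
    · simp only [h1, h2, not_le.mp h2, if_true, if_false]; ring
    · simp only [h1, h2, not_le.mp h1, if_true, if_false]; ring
    · omega
  · have h' : ¬ x.1.2 + x.1.1 = x.2 + (k + j) := by omega
    simp [h, h']

end Lax

/-- The part of the Lax equation lost by truncating matrices to size `N`. -/
def truncError (c : ℕ → ℂ) (N j k : ℕ) : ℂ :=
  -Complex.I * (∑' l, laxEntry c j (l + N) * c (l + N + k) +
    ∑' l, laxEntry c k (l + N) * c (l + N + j))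

/-- The truncated Hankel matrix of a sequence. -/
def hankel (c : ℕ → ℂ) (N : ℕ) : Matrix (Fin N) (Fin N) ℂ :=
  Matrix.of fun j k => c (j + k)

/-- The truncated anti-Hermitian matrix of the Lax pair. -/
def laxMatrix (c : ℕ → ℂ) (N : ℕ) : Matrix (Fin N) (Fin N) ℂ :=
  Matrix.of fun j k => -Complex.I * laxEntry c j k

theorem conjTranspose_laxMatrix (c : ℕ → ℂ) (N : ℕ) : (laxMatrix c N)ᴴ = -laxMatrix c N := by
  ext j k
  simp [laxMatrix, Matrix.conjTranspose_apply, conj_laxEntry]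

theorem cubicCoeff_hankel {c : ℕ → ℂ} (hc : Summable fun k => ‖c k‖) (N : ℕ) (j k : Fin N) :
    -Complex.I * cubicCoeff c (j + k) =
      (laxMatrix c N * hankel c N + hankel c N * (laxMatrix c N)ᵀ +
        Matrix.of fun j k : Fin N => truncError c N j k) j k := by
  have hs : ∀ j k : ℕ, Summable fun l => laxEntry c j l * c (l + k) := fun j k => by
    refine ((hc.comp_injective (add_left_injective k)).mul_left
      ((∑' k, ‖c k‖) ^ 2)).of_norm_bounded fun l => ?_
    rw [norm_mul]
    exact mul_le_mul_of_nonneg_right (norm_laxEntry_le hc j l) (norm_nonneg _)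
  rw [cubicCoeff_add_eq hc, ← (hs j k).sum_add_tsum_nat_add N, ← (hs k j).sum_add_tsum_nat_add N,
    ← Fin.sum_univ_eq_sum_range, ← Fin.sum_univ_eq_sum_range]
  simp only [Matrix.add_apply, Matrix.mul_apply, Matrix.of_apply, Matrix.transpose_apply,
    laxMatrix, hankel, truncError, mul_add, Finset.mul_sum]
  have e : ∑ x : Fin N, c (j + x) * (-Complex.I * laxEntry c k x) =
      ∑ x : Fin N, -Complex.I * (laxEntry c k x * c (x + j)) :=
    Finset.sum_congr rfl fun x _ => by rw [add_comm (j : ℕ)]; ring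
  rw [e]
  simp only [mul_assoc]
  ring

/-- Of the five powers of decay, two make the sum over `l` converge and three beat the `N²` entries
of the error matrix. -/
theorem norm_truncError_le {c : ℕ → ℂ} {C S : ℝ} (hc : Summable fun k => ‖c k‖)
    (hS : ∑' k, ‖c k‖ ≤ S) (hC : ∀ k : ℕ, (1 + (k : ℝ)) ^ 5 * ‖c k‖ ≤ C) (N j k : ℕ) :
    ‖truncError c N j k‖ ≤
      2 * (S ^ 2 * (C * ((1 + (N : ℝ)) ^ 3)⁻¹ * ∑' l : ℕ, ((1 + (l : ℝ)) ^ 2)⁻¹)) := by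
  have hS0 : 0 ≤ ∑' k, ‖c k‖ := tsum_nonneg fun _ => norm_nonneg _
  have hC0 : 0 ≤ C := by
    have := hC 0
    exact le_trans (by positivity) this
  have hterm : ∀ j k l : ℕ, ‖laxEntry c j (l + N) * c (l + N + k)‖ ≤
      S ^ 2 * (C * ((1 + (N : ℝ)) ^ 3)⁻¹ * ((1 + (l : ℝ)) ^ 2)⁻¹) := fun j k l => by
    rw [norm_mul]
    refine mul_le_mul ((norm_laxEntry_le hc _ _).trans (by gcongr)) ?_ (norm_nonneg _)
      (by positivity)
    have h1 := hC (l + N + k)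
    have h2 : (1 + (N : ℝ)) ^ 3 * (1 + (l : ℝ)) ^ 2 ≤ (1 + ((l + N + k : ℕ) : ℝ)) ^ 5 := by
      rw [show (1 + ((l + N + k : ℕ) : ℝ)) ^ 5 =
        (1 + ((l + N + k : ℕ) : ℝ)) ^ 3 * (1 + ((l + N + k : ℕ) : ℝ)) ^ 2 by ring]
      push_cast
      gcongr <;> linarith [(Nat.cast_nonneg l : (0 : ℝ) ≤ l), (Nat.cast_nonneg N : (0 : ℝ) ≤ N),
        (Nat.cast_nonneg k : (0 : ℝ) ≤ k)]
    have h3 := (mul_le_mul_of_nonneg_right h2 (norm_nonneg (c (l + N + k)))).trans h1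
    rw [mul_assoc C, ← mul_inv, ← div_eq_mul_inv, le_div_iff₀ (by positivity)]
    linarith
  have hsum : ∀ j k : ℕ, ‖∑' l, laxEntry c j (l + N) * c (l + N + k)‖ ≤
      S ^ 2 * (C * ((1 + (N : ℝ)) ^ 3)⁻¹ * ∑' l : ℕ, ((1 + (l : ℝ)) ^ 2)⁻¹) := fun j k =>
    tsum_of_norm_bounded
      ((summable_one_add_inv_sq.hasSum.mul_left (C * ((1 + (N : ℝ)) ^ 3)⁻¹)).mul_left (S ^ 2))
      (hterm j k)
  rw [truncError, norm_mul, norm_neg, Complex.norm_I, one_mul, two_mul]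
  exact (norm_add_le _ _).trans (add_le_add (hsum j k) (hsum k j))

theorem norm_traceForm_truncError_le {c : ℕ → ℂ} {N : ℕ} {X : ℝ} (hN : 0 < N) (hX : 0 ≤ X)
    (h : ∀ j k, ‖truncError c N j k‖ ≤ X * ((1 + (N : ℝ)) ^ 3)⁻¹) :
    ‖traceForm (Matrix.of fun j k : Fin N => truncError c N j k)‖ < (X + 1) / N := by
  have hN' : (0 : ℝ) < N := by exact_mod_cast hN
  refine (norm_traceForm_le _).trans_lt ?_
  calc _ ≤ ∑ _j : Fin N, ∑ _k : Fin N, X * ((1 + (N : ℝ)) ^ 3)⁻¹ :=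
        Finset.sum_le_sum fun j _ => Finset.sum_le_sum fun k _ => h j k
    _ = X * (N ^ 2 * ((1 + (N : ℝ)) ^ 3)⁻¹) := by
        simp only [Finset.sum_const, Finset.card_univ, Fintype.card_fin, nsmul_eq_mul]; ring
    _ ≤ X * (N : ℝ)⁻¹ := by
        refine mul_le_mul_of_nonneg_left ?_ hX
        rw [← div_eq_mul_inv, inv_eq_one_div, div_le_div_iff₀ (by positivity) hN']
        nlinarith [pow_pos hN' 2]
    _ < (X + 1) / N := by rw [← div_eq_mul_inv]; gcongr; linarith

theorem sum_range_two_mul (f : ℕ → ℝ) (N : ℕ) :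
    ∑ m ∈ Finset.range (2 * N), f m =
      ∑ j ∈ Finset.range N, f (2 * j) + ∑ j ∈ Finset.range N, f (2 * j + 1) := by
  induction N with
  | zero => simp
  | succ N ih =>
    rw [mul_add, mul_one, Finset.sum_range_succ, Finset.sum_range_succ, ih,
      Finset.sum_range_succ _ N, Finset.sum_range_succ _ N]
    ring

/-- The diagonal of the Hankel matrix lists the even coefficients, the cyclic shift of it the odd
ones. Size `N + 1` leaves room for the shift; the last entry of each is discarded. -/
theorem sum_norm_le_traceForm_hankel (c : ℕ → ℂ) (N : ℕ) :
    ∑ m ∈ Finset.range (2 * N), ‖c m‖ ≤ 2 * ‖traceForm (hankel c (N + 1))‖ := by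
  have h1 := sum_norm_perm_le (hankel c (N + 1)) 1
  have h2 := sum_norm_perm_le (hankel c (N + 1)) (finRotate (N + 1))
  rw [Fin.sum_univ_castSucc] at h1 h2
  simp only [hankel, Matrix.of_apply, Equiv.Perm.one_apply, finRotate_apply,
    Fin.val_castSucc, Fin.coeSucc_eq_succ, Fin.val_succ] at h1 h2
  rw [Fin.sum_univ_eq_sum_range (fun j => ‖c (j + j)‖)] at h1
  rw [Fin.sum_univ_eq_sum_range (fun j => ‖c (j + (j + 1))‖)] at h2
  rw [sum_range_two_mul]
  have e1 : ∀ j, ‖c (2 * j)‖ = ‖c (j + j)‖ := fun j => by rw [two_mul]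
  have e2 : ∀ j, ‖c (2 * j + 1)‖ = ‖c (j + (j + 1))‖ := fun j => by rw [two_mul, add_assoc]
  simp only [e1, e2]
  have p1 := norm_nonneg (c (Fin.last N + Fin.last N : ℕ))
  have p2 := norm_nonneg (c (Fin.last N + (Fin.last N + 1 : Fin (N + 1)) : ℕ))
  rw [two_mul]
  unfold hankel
  exact add_le_add (by linarith) (by linarith)

namespace SzegoFlow

variable {c : ℝ → ℕ → ℂ}

theorem summable_hankel (h : SzegoFlow c) (t : ℝ) :
    Summable fun x : ℕ × ℕ => ‖c t (x.1 + x.2)‖ := by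
  obtain ⟨C, h0, hC⟩ := h.decay 4 |t|
  have hs := (summable_one_add_inv_sq.mul_of_nonneg summable_one_add_inv_sq
    (fun _ => by positivity) (fun _ => by positivity)).mul_left C
  refine hs.of_nonneg_of_le (fun _ => norm_nonneg _) fun x => ?_
  have h1 := hC t le_rfl (x.1 + x.2)
  have h2 : (1 + (x.1 : ℝ)) ^ 2 * (1 + (x.2 : ℝ)) ^ 2 ≤ (1 + ((x.1 + x.2 : ℕ) : ℝ)) ^ 4 := by
    rw [show (1 + ((x.1 + x.2 : ℕ) : ℝ)) ^ 4 =
      (1 + ((x.1 + x.2 : ℕ) : ℝ)) ^ 2 * (1 + ((x.1 + x.2 : ℕ) : ℝ)) ^ 2 by ring]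
    push_cast
    gcongr <;> linarith [(Nat.cast_nonneg x.1 : (0 : ℝ) ≤ x.1),
      (Nat.cast_nonneg x.2 : (0 : ℝ) ≤ x.2)]
  have h3 := (mul_le_mul_of_nonneg_right h2 (norm_nonneg (c t (x.1 + x.2)))).trans h1
  rw [← mul_inv, ← div_eq_mul_inv, le_div_iff₀ (by positivity)]
  linarith

theorem traceForm_hankel_zero_le (h : SzegoFlow c) (N : ℕ) :
    ‖traceForm (hankel (c 0) N)‖ ≤ ∑' x : ℕ × ℕ, ‖c 0 (x.1 + x.2)‖ := by
  refine (norm_traceForm_le _).trans ?_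
  have := (h.summable_hankel 0).sum_le_tsum (Finset.range N ×ˢ Finset.range N)
    (fun _ _ => norm_nonneg _)
  refine le_trans (le_of_eq ?_) this
  rw [Finset.sum_product, ← Fin.sum_univ_eq_sum_range
    (fun j => ∑ k ∈ Finset.range N, ‖c 0 (j + k)‖)]
  refine Finset.sum_congr rfl fun j _ => ?_
  rw [← Fin.sum_univ_eq_sum_range (fun k => ‖c 0 (j + k)‖)]
  rfl

/-- At fixed `t`, the truncated trace norm starts below `K` and drifts by `O(t / N)`; let `N → ∞`.
-/
theorem tsum_norm_le_of_nonneg (h : SzegoFlow c) {t : ℝ} (ht : 0 ≤ t) :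
    ∑' k, ‖c t k‖ ≤ 2 * ∑' x : ℕ × ℕ, ‖c 0 (x.1 + x.2)‖ := by
  set K := ∑' x : ℕ × ℕ, ‖c 0 (x.1 + x.2)‖
  obtain ⟨C, h0, hC⟩ := h.decay 5 t
  obtain ⟨b, hb, hb0, hbN⟩ := h.exists_summable_bound 0 t
  set X := 2 * ((∑' j, b j) ^ 2 * (C * ∑' l : ℕ, ((1 + (l : ℝ)) ^ 2)⁻¹)) with hX
  have hZ : 0 ≤ ∑' l : ℕ, ((1 + (l : ℝ)) ^ 2)⁻¹ := tsum_nonneg fun _ => by positivity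
  have hX0 : 0 ≤ X := by positivity
  have step : ∀ N : ℕ, ∑ m ∈ Finset.range (2 * N), ‖c t m‖ ≤
      2 * (K + (X + 1) / ((N + 1 : ℕ) : ℝ) * t) := fun N => by
    refine (sum_norm_le_traceForm_hankel (c t) N).trans ?_
    refine mul_le_mul_of_nonneg_left ?_ zero_le_two
    refine norm_traceForm_le_of_lax (M := fun τ => hankel (c τ) (N + 1))
      (A := fun τ => laxMatrix (c τ) (N + 1))
      (E := fun τ => Matrix.of fun j k : Fin (N + 1) => truncError (c τ) (N + 1) j k)
      (T := t) (fun τ => conjTranspose_laxMatrix _ _) (fun τ j k => ?_) (fun τ hτ => ?_)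
      (h.traceForm_hankel_zero_le _) t ⟨ht, le_rfl⟩
    · exact (h.hasDeriv τ (j + k)).congr_deriv (cubicCoeff_hankel (h.summable_norm τ) (N + 1) j k)
    · have hτ' : |τ| ≤ t := by rw [abs_of_nonneg hτ.1]; exact hτ.2
      refine norm_traceForm_truncError_le N.succ_pos hX0 fun j k => ?_
      refine (norm_truncError_le (h.summable_norm τ) (S := ∑' j, b j) ?_ (hC τ hτ') _ j k).trans
        (le_of_eq ?_)
      · refine (h.summable_norm τ).tsum_le_tsum (fun j => ?_) hb
        simpa using hbN τ hτ' j
      · rw [hX]; ring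
  have hlim : Tendsto (fun N : ℕ => 2 * (K + (X + 1) / ((N + 1 : ℕ) : ℝ) * t)) atTop
      (𝓝 (2 * K)) := by
    have h1 : Tendsto (fun N : ℕ => (X + 1) / ((N + 1 : ℕ) : ℝ)) atTop (𝓝 0) :=
      (tendsto_const_div_atTop_nhds_zero_nat (X + 1)).comp (tendsto_add_atTop_nat 1)
    simpa using ((h1.mul_const t).const_add K).const_mul 2
  have hsum : Tendsto (fun N : ℕ => ∑ m ∈ Finset.range (2 * N), ‖c t m‖) atTop
      (𝓝 (∑' k, ‖c t k‖)) :=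
    (h.summable_norm t).hasSum.tendsto_sum_nat.comp
      (tendsto_id.const_mul_atTop' two_pos)
  exact le_of_tendsto_of_tendsto' hsum hlim step

theorem tsum_norm_le (h : SzegoFlow c) (t : ℝ) :
    ∑' k, ‖c t k‖ ≤ 2 * ∑' x : ℕ × ℕ, ‖c 0 (x.1 + x.2)‖ := by
  rcases le_total 0 t with ht | ht
  · exact h.tsum_norm_le_of_nonneg ht
  · simpa using h.reverse.tsum_norm_le_of_nonneg (neg_nonneg.mpr ht)

end SzegoFlow
end

/-! ### From coefficient sequences back to Sobolev norms. -/

noncomputable section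

section Sobolev

variable {f : SzegoTorus → ℂ}

theorem sobolevTerm_natCast (n : ℕ) (f : SzegoTorus → ℂ) (k : ℕ) :
    sobolevTerm (1 + (n : ℝ)) f (k : ℤ) = sobolevWeight n k * ‖fourierCoeff f (k : ℤ)‖ ^ 2 := by
  rw [sobolevTerm, sobolevWeight, ← Real.rpow_natCast _ (n + 1)]
  push_cast
  rw [add_comm (n : ℝ) 1]

theorem sobolevTerm_nonneg (s : ℝ) (f : SzegoTorus → ℂ) (k : ℤ) : 0 ≤ sobolevTerm s f k := by
  unfold sobolevTerm; positivity

theorem sobolevNorm_sq (s : ℝ) (f : SzegoTorus → ℂ) :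
    sobolevNorm s f ^ 2 = ∑' k, sobolevTerm s f k :=
  Real.sq_sqrt (tsum_nonneg fun k => sobolevTerm_nonneg s f k)

theorem sobolevTerm_eq_zero (hf : ∀ k : ℤ, k < 0 → fourierCoeff f k = 0) (s : ℝ) {k : ℤ}
    (hk : k ∉ Set.range ((↑) : ℕ → ℤ)) : sobolevTerm s f k = 0 := by
  have : k < 0 := by
    by_contra h
    exact hk ⟨k.toNat, by simpa using h⟩
  simp [sobolevTerm, hf k this]

theorem sobolevNorm_sq_of_nonneg_freq (hf : ∀ k : ℤ, k < 0 → fourierCoeff f k = 0) (s : ℝ) :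
    sobolevNorm s f ^ 2 = ∑' k : ℕ, sobolevTerm s f (k : ℤ) := by
  rw [sobolevNorm_sq]
  refine (Function.Injective.tsum_eq Nat.cast_injective fun k hk => ?_).symm
  by_contra h
  exact hk (sobolevTerm_eq_zero hf s h)

theorem finiteSobolev_of_nonneg_freq (hf : ∀ k : ℤ, k < 0 → fourierCoeff f k = 0) {s : ℝ}
    (h : Summable fun k : ℕ => sobolevTerm s f (k : ℤ)) : FiniteSobolev s f :=
  (Function.Injective.summable_iff Nat.cast_injective
    fun _ hk => sobolevTerm_eq_zero hf s hk).mp h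

theorem tsum_half_le (hf : ∀ k : ℤ, k < 0 → fourierCoeff f k = 0)
    (hs : Summable fun k : ℕ => (1 + (k : ℝ)) * ‖fourierCoeff f (k : ℤ)‖ ^ 2) :
    ∑' k : ℕ, (1 + (k : ℝ)) * ‖fourierCoeff f (k : ℤ)‖ ^ 2 ≤ 2 * sobolevNorm (1 / 2) f ^ 2 := by
  rw [sobolevNorm_sq_of_nonneg_freq hf, ← tsum_mul_left]
  have hw : ∀ k : ℕ, ((1 : ℝ) + ((k : ℤ) : ℝ) ^ 2) ^ (1 / 2 : ℝ) = √(1 + (k : ℝ) ^ 2) := fun k => by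
    rw [Real.sqrt_eq_rpow]; simp
  have hle : ∀ k : ℕ, √(1 + (k : ℝ) ^ 2) ≤ 1 + k := fun k => by
    rw [Real.sqrt_le_left (by positivity)]
    nlinarith [(Nat.cast_nonneg k : (0 : ℝ) ≤ k)]
  have hge : ∀ k : ℕ, 1 + (k : ℝ) ≤ 2 * √(1 + (k : ℝ) ^ 2) := fun k => by
    have h1 := Real.sq_sqrt (show 0 ≤ 1 + (k : ℝ) ^ 2 by positivity)
    refine le_of_sq_le_sq ?_ (by positivity)
    rw [mul_pow, h1]
    nlinarith [sq_nonneg ((k : ℝ) - 1)]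
  have hs2 : Summable fun k : ℕ => sobolevTerm (1 / 2) f (k : ℤ) := by
    refine hs.of_nonneg_of_le (fun k => sobolevTerm_nonneg _ _ _) fun k => ?_
    rw [sobolevTerm, hw]
    exact mul_le_mul_of_nonneg_right (hle k) (by positivity)
  refine hs.tsum_le_tsum (fun k => ?_) (hs2.mul_left 2)
  rw [sobolevTerm, hw, ← mul_assoc]
  exact mul_le_mul_of_nonneg_right (hge k) (by positivity)

end Sobolev

/-- The linear exponential rate is dominated by a Gaussian rate. -/
theorem half_mul_abs_le {r B' : ℝ} (hB : 0 < B') (t : ℝ) :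
    r * |t| ≤ B' * |t| ^ 2 + r ^ 2 / (4 * B') := by
  have h : 0 ≤ (2 * B' * |t| - r) ^ 2 / (4 * B') := by positivity
  have e : (2 * B' * |t| - r) ^ 2 / (4 * B') = B' * |t| ^ 2 + r ^ 2 / (4 * B') - r * |t| := by
    field_simp; ring
  linarith

end

/-! ### The two growth bounds. -/

theorem mainTheorem8 (n : ℕ) :
    ∃ B : ℝ, 0 < B ∧
      -- every solution, with a constant depending only on `n` and the `H^{1+n}` norm of the data
      (∃ C : ℝ → ℝ, (∀ R : ℝ, 0 < C R) ∧
        ∀ (u₀ : SzegoTorus → ℂ) (u : ℝ → SzegoTorus → ℂ),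
          SmoothPlus u₀ → IsSzegoSolution u₀ u → ∀ t : ℝ,
            FiniteSobolev (1 + (n : ℝ)) (u t) ∧
            sobolevNorm (1 + (n : ℝ)) (u t) ≤
              C (sobolevNorm (1 + (n : ℝ)) u₀) *
                Real.exp (B * max 1 (sobolevNorm (1 / 2) u₀) ^ 8 * |t| ^ 2)) ∧
      -- every solution, small or large, at the rate `B ‖u₀‖^8`
      (∀ (u₀ : SzegoTorus → ℂ) (u : ℝ → SzegoTorus → ℂ),
          SmoothPlus u₀ → IsSzegoSolution u₀ u →
            ∃ C : ℝ, 0 < C ∧ ∀ t : ℝ,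
              sobolevNorm (1 + (n : ℝ)) (u t) ≤
                C * Real.exp (B * sobolevNorm (1 / 2) u₀ ^ 8 * |t| ^ 2)) := by
  have hE := energyConst_pos n
  have hsob : ∀ {u₀ : SzegoTorus → ℂ} {u : ℝ → SzegoTorus → ℂ}, SmoothPlus u₀ →
      IsSzegoSolution u₀ u → ∀ t, sobolevNorm (1 + (n : ℝ)) (u t) ^ 2 =
        ∑' k : ℕ, sobolevWeight n k * ‖fourierCoeff (u t) (k : ℤ)‖ ^ 2 := fun h₀ hu t => by
    rw [sobolevNorm_sq_of_nonneg_freq ((hu.szegoFlow h₀).2 t)]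
    exact tsum_congr fun k => sobolevTerm_natCast n _ k
  have hhalf : ∀ {u₀ : SzegoTorus → ℂ} {u : ℝ → SzegoTorus → ℂ}, SmoothPlus u₀ →
      IsSzegoSolution u₀ u → ∑' k : ℕ, (1 + (k : ℝ)) * ‖fourierCoeff (u 0) (k : ℤ)‖ ^ 2 ≤
        2 * sobolevNorm (1 / 2) u₀ ^ 2 := fun {u₀ u} h₀ hu => by
    have h := tsum_half_le ((hu.szegoFlow h₀).2 0) ((hu.szegoFlow h₀).1.summable_half 0)
    rwa [hu.initial] at h ⊢
  -- With `m = 2x`, the exponent for the squared norm is `32 E² x⁴ t²`, where `E` is `energyConst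
  -- n`; the square root halves it to `16`.
  refine ⟨16 * energyConst n ^ 2, by positivity, ⟨fun R => 3 + R ^ 2, fun R => by positivity,
    fun u₀ u h₀ hu t => ⟨?_, ?_⟩⟩, fun u₀ u h₀ hu => ?_⟩
  · obtain ⟨hflow, hneg⟩ := hu.szegoFlow h₀
    refine finiteSobolev_of_nonneg_freq (hneg t) ?_
    simp_rw [sobolevTerm_natCast]
    exact hflow.summable_sobolev n t
  · obtain ⟨hflow, hneg⟩ := hu.szegoFlow h₀
    set M := sobolevNorm (1 / 2) u₀ with hM
    have hM0 : 0 ≤ M := Real.sqrt_nonneg _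
    set x := max 1 M with hx
    have hx1 : 1 ≤ x := le_max_left _ _
    have hxM : M ≤ x := le_max_right _ _
    have hQ : ∑' k : ℕ, (1 + (k : ℝ)) * ‖fourierCoeff (u 0) (k : ℤ)‖ ^ 2 ≤ (2 * x) ^ 2 :=
      (hhalf h₀ hu).trans (by nlinarith)
    have key := hflow.sobolev_le_gaussian n (by linarith : 1 ≤ 2 * x) hQ t
    rw [← hsob h₀ hu, ← hsob h₀ hu 0, hu.initial] at key
    change _ ≤ (3 + sobolevNorm (1 + (n : ℝ)) u₀ ^ 2) * _
    refine le_of_sq_le_sq (key.trans ?_) (by positivity)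
    rw [mul_pow _ (Real.exp _), ← Real.exp_nat_mul]
    refine mul_le_mul_of_nonneg_left (Real.exp_le_exp.mpr ?_) (by positivity)
    -- The argument yields a fourth power; passing to the eighth requires `x ≥ 1`.
    have hx8 : x ^ 4 ≤ x ^ 8 := pow_le_pow_right₀ hx1 (by norm_num)
    calc 2 * (energyConst n * (2 * x) ^ 2 * |t|) ^ 2
        = 32 * energyConst n ^ 2 * |t| ^ 2 * x ^ 4 := by ring
      _ ≤ 32 * energyConst n ^ 2 * |t| ^ 2 * x ^ 8 := by gcongr
      _ = _ := by push_cast; ring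
  · obtain ⟨hflow, hneg⟩ := hu.szegoFlow h₀
    set M := sobolevNorm (1 / 2) u₀ with hM
    have hM0 : 0 ≤ M := Real.sqrt_nonneg _
    set K := ∑' y : ℕ × ℕ, ‖fourierCoeff u₀ ((y.1 + y.2 : ℕ) : ℤ)‖ with hK
    have hK0 : 0 ≤ K := tsum_nonneg fun _ => norm_nonneg _
    set F₀ := sobolevNorm (1 + (n : ℝ)) u₀ ^ 2 with hF₀
    have hF₀0 : 0 ≤ F₀ := by positivity
    have key : ∀ μ : ℝ, 0 < μ → 2 * M ^ 2 ≤ μ ^ 2 → ∀ t,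
        sobolevNorm (1 + (n : ℝ)) (u t) ^ 2 ≤
          (1 + F₀) * Real.exp (energyConst n * K * μ * |t|) := fun μ hμ hMμ t => by
      have h1 := hflow.sobolev_le_of_tsum_norm_le n hμ ((hhalf h₀ hu).trans hMμ)
        hflow.tsum_norm_le t
      rw [← hsob h₀ hu, ← hsob h₀ hu 0, hu.initial] at h1
      refine h1.trans (le_of_eq ?_)
      congr 2
      ring
    -- A bound `X ≥ 1` on the square also bounds the norm, as `X ≤ X²`.
    have hle : ∀ {y L : ℝ}, 1 ≤ Real.exp L → y ^ 2 ≤ (1 + F₀) * Real.exp L →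
        y ≤ (1 + F₀) * Real.exp L := fun {y L} hL hy => by
      refine le_of_sq_le_sq (hy.trans ?_) (by positivity)
      exact le_self_pow₀ (one_le_mul_of_one_le_of_one_le (by linarith) hL) two_ne_zero
    rcases hM0.eq_or_lt with hM0 | hM0
    · refine ⟨(1 + F₀) * Real.exp 1, by positivity, fun t => ?_⟩
      rw [← hM0]
      have hp : 0 < 1 + energyConst n * K * |t| := by positivity
      -- When `M = 0` the claimed bound is constant in time. Every `μ > 0` is admissible, so it is
      -- chosen depending on `t` to keep the exponent below `1`.
      have h1 := key (1 + energyConst n * K * |t|)⁻¹ (inv_pos.mpr hp)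
        (by rw [← hM0]; simpa using sq_nonneg _) t
      simp only [ne_eq, OfNat.ofNat_ne_zero, not_false_eq_true, zero_pow, mul_zero, zero_mul,
        Real.exp_zero, mul_one]
      refine hle (Real.one_le_exp zero_le_one) (h1.trans ?_)
      gcongr
      rw [mul_right_comm, ← div_eq_mul_inv, div_le_one hp]
      linarith
    -- When `M > 0` the growth is exponential with linear rate `r`, and completing the square
    -- absorbs it into the Gaussian of rate `B'`. The cost `exp (r² / (4B'))` depends on the data
    -- through `K` and `M`.
    · set B' := 16 * energyConst n ^ 2 * M ^ 8 with hB'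
      have hB'0 : 0 < B' := by positivity
      set r := energyConst n * K * (2 * M) with hr
      refine ⟨(1 + F₀) * Real.exp (r ^ 2 / (4 * B')), by positivity, fun t => ?_⟩
      have h1 := key (2 * M) (by positivity) (by nlinarith) t
      rw [mul_assoc, ← Real.exp_add]
      refine hle (Real.one_le_exp (by positivity)) (h1.trans ?_)
      gcongr
      have := half_mul_abs_le (r := r) hB'0 t
      linarith
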